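/- Consider on $\mathbb{C}^2$ the polynomial $H=x^2+y^2$, the one-forms $\omega_1=(H-1)(y\,dx-x\,dy)$ and $\omega_2=y\,dH$, and the foliation by the complex curves tangent to $\ker\bigl(dH+\varepsilon(\omega_1+a\omega_2)\bigr)$, where $a,\varepsilon\in\mathbb{C}$. Near the real unit circle use the chart $f(z,w)=\bigl(\tfrac{\cos z}{\sqrt{1-w}},\tfrac{\sin z}{\sqrt{1-w}}\bigr)$, $|w|<1$. The local Poincaré map $P_{a,\varepsilon}$ sends $u$ to $v$ if the path $t\mapsto (t,0)$, $t\in[0,2\pi]$, lifts along $(z,w)\mapsto z$ to a path in the leaf through $f(0,u)$, and this lift ends at $f(2\pi,v)$. Write $D_r=\{|\zeta|<r\}\subset\mathbb{C}$. For every $r_3>0$ there are $r_1\in(0,1)$ and $r_2>0$ such that for all $(a,\varepsilon)\in D_{r_2}\times D_{r_3}$ the map $P_{a,\varepsilon}:D_{r_1}\to\mathbb{C}$ is well defined. Let $r_1\in(0,1)$, $r_2>0$, $r_3>0$ be any radii with this property and let $m\ge 1$ be an integer with $i/m\in D_{r_3}$. Then: (1) Arbitrarily close to $i/m$ there is a parameter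 $\varepsilon_m$, and there is $a_m\in D_{r_2}$, such that for all $\varepsilon$ in a neighbourhood of $\varepsilon_m$ (contained in $D_{r_3}$) the map $P_{a_m,\varepsilon}$ has in $D_{r_1}\setminus\{0\}$ an isolated periodic orbit of exact period $m$, that is, an orbit of $m$ distinct points each of which is an isolated fixed point of $P_{a_m,\varepsilon}^m$. (2) As $a\to0$, uniformly for $u\in D_{r_1}$, the iterate $P^m_{a,i/m}(u)$ is defined and $$P^m_{a,i/m}(u)=u+a\,c_m\,u^{m+1}+O(|a|^2|u|),\qquad c_m=\frac{i}{m}\,\pi\, b_m\neq 0,$$ where $(1-w)^{-1/2}=\sum_{k\ge0}b_kw^k$, that is, $b_k=\dfrac{(-1)^k}{k!}\prod_{j=0}^{k-1}\bigl(-\tfrac12-j\bigr)$. -/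

import Mathlib

open scoped Topology

/-- The polynomial `H(x, y) = x² + y²` on `ℂ²`. -/
def cycleH (p : ℂ × ℂ) : ℂ := p.1 ^ 2 + p.2 ^ 2

/-- The one-form `ω₁ = (H - 1)(y dx - x dy)`. -/
noncomputable def cycleOmega1 (p : ℂ × ℂ) : (ℂ × ℂ) →L[ℂ] ℂ :=
  (cycleH p - 1) •
    (p.2 • ContinuousLinearMap.fst ℂ ℂ ℂ - p.1 • ContinuousLinearMap.snd ℂ ℂ ℂ)

/-- The one-form `ω₂ = y dH`. -/
noncomputable def cycleOmega2 (p : ℂ × ℂ) : (ℂ × ℂ) →L[ℂ] ℂ :=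
  p.2 • fderiv ℂ cycleH p

/-- The one-form `dH + ε (ω₁ + a ω₂)`, whose kernel is the line field of the foliation. -/
noncomputable def cycleForm (a ε : ℂ) (p : ℂ × ℂ) : (ℂ × ℂ) →L[ℂ] ℂ :=
  fderiv ℂ cycleH p + ε • (cycleOmega1 p + a • cycleOmega2 p)

/-- The chart `f(z, w) = (cos z / √(1 - w), sin z / √(1 - w))` around the unit circle, used for
`|w| < 1` (principal branch of the root). The unit circle is `w = 0`, `z ∈ [0, 2π]`. -/
noncomputable def cycleChart (z w : ℂ) : ℂ × ℂ :=
  ((1 - w) ^ (-(1 / 2) : ℂ) * Complex.cos z, (1 - w) ^ (-(1 / 2) : ℂ) * Complex.sin z)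

/-- `t ↦ f(t, w t)`, `t ∈ [0, 2π]`, is a path on a leaf of the foliation `ker (dH + ε(ω₁ + a ω₂))`:
it avoids the singular points and is tangent to the line field. It covers the path
`t ↦ (t, 0)` (that is, the unit circle run once) under the projection `(z, w) ↦ z`. -/
def IsCycleLift (a ε : ℂ) (w : ℝ → ℂ) : Prop :=
  ∀ t ∈ Set.Icc (0 : ℝ) (2 * Real.pi),
    ‖w t‖ < 1 ∧ cycleForm a ε (cycleChart t (w t)) ≠ 0 ∧
    ∃ v : ℂ × ℂ,
      HasDerivWithinAt (fun s : ℝ => cycleChart s (w s)) v (Set.Icc 0 (2 * Real.pi)) t ∧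
      cycleForm a ε (cycleChart t (w t)) v = 0

/-- The lift of the unit circle that starts at `(0, u)` exists and ends at `(2π, v)`. -/
def IsCycleReturn (a ε u v : ℂ) : Prop :=
  ∃ w : ℝ → ℂ, IsCycleLift a ε w ∧ w 0 = u ∧ w (2 * Real.pi) = v

open Classical in
/-- The local Poincaré map `P_{a,ε}`, in the coordinate `w` of the cross-section `z = 0`
(with value `0` where the lift does not exist). -/
noncomputable def cyclePoincare (a ε u : ℂ) : ℂ :=
  if h : ∃ v, IsCycleReturn a ε u v then h.choose else 0

/-- For all `|a| < r₂` and `|ε| < r₃`, the Poincaré map is well defined on the disc `|u| < r₁`. -/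
def CyclePoincareWellDefined (r₁ r₂ r₃ : ℝ) : Prop :=
  ∀ a ∈ Metric.ball (0 : ℂ) r₂, ∀ ε ∈ Metric.ball (0 : ℂ) r₃, ∀ u ∈ Metric.ball (0 : ℂ) r₁,
    ∃! v, IsCycleReturn a ε u v

/-- The orbit of `u` under `P`, a map given on the open set `D`, is an isolated periodic orbit of
exact period `m` contained in `D`: each of its points `q` is an isolated fixed point of `P^m`
(on a neighbourhood of `q` where `P^m` is defined, `q` is the only fixed point of `P^m`). -/
def IsIsolatedPeriodicOrbit (P : ℂ → ℂ) (D : Set ℂ) (m : ℕ) (u : ℂ) : Prop :=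
  Function.minimalPeriod P u = m ∧
  ∀ j < m, P^[j] u ∈ D ∧
    ∃ V ∈ 𝓝 (P^[j] u), ∀ v ∈ V, (∀ k < m, P^[k] v ∈ D) ∧ (P^[m] v = v → v = P^[j] u)

/-- The Taylor coefficients of `(1 - w)^(-1/2) = ∑ b_k w^k`. -/
noncomputable def cycleB (k : ℕ) : ℂ :=
  (-1) ^ k * (∏ j ∈ Finset.range k, (-(1 / 2) - (j : ℂ))) / (k.factorial : ℂ)

/-- The leading coefficient `c_m = (i/m) π b_m`. -/
noncomputable def cycleC (m : ℕ) : ℂ :=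
  Complex.I / (m : ℂ) * (Real.pi : ℂ) * cycleB m

/-! In the chart, `H = 1/(1-w)` and the leaves are the solutions of `w' = ε w / (1 + a ε sin t
(1-w)^(-1/2))` (`isCycleLift_iff`). For `a = 0` this gives `P(u) = exp(2πε) u`, and at `ε = i/m` the
map is a rotation of order `m`.

For small `a`, write `w = u exp(εt + q)`; then `q' = -a ε² sin t (1-w)^(-1/2) / (1 + a ε sin t
(1-w)^(-1/2))`. Picard-Lindelöf on the whole interval `[0, 2πm]` gives `q = O(a)` and its
first-order part (`exists_cycleSolution`). At `ε = i/m`, expanding the root along the rotation `u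
exp(it/m)` and integrating against `sin t` keeps only the `m`-th Taylor term, so the first-order
part is `a c_m u^m` (`integral_firstOrder`).

Hence `P^m(u) - u = u (2πm (ε - i/m) + a c_m u^m) + O((|a| + |ε - i/m|)² |u|)`
(`exists_iterate_cyclePoincare`). At `ε = i/m` this is assertion (2). For (1), `ε_m` is chosen so
that the bracket vanishes at a prescribed `u₀ ≠ 0`. A quantitative open mapping theorem turns this
into a true zero (`exists_isolated_zero`), the identity theorem isolates it, and closeness to the
rotation excludes smaller periods. -/

/-! ### The branch of `(1 - w)^(-1/2)` on the unit disc -/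

/-- The principal branch of `(1 - w)^(-1/2)`, the radius of the circle `H = 1 / (1 - w)`. -/
noncomputable def invSqrt (w : ℂ) : ℂ := (1 - w) ^ (-(1 / 2) : ℂ)

lemma one_sub_mem_slitPlane {w : ℂ} (hw : ‖w‖ < 1) : 1 - w ∈ Complex.slitPlane := by
  rw [sub_eq_add_neg]
  exact Complex.mem_slitPlane_of_norm_lt_one (by simpa using hw)

lemma one_sub_ne_zero_of_norm_lt_one {w : ℂ} (hw : ‖w‖ < 1) : 1 - w ≠ 0 :=
  Complex.slitPlane_ne_zero (one_sub_mem_slitPlane hw)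

lemma invSqrt_sq {w : ℂ} (hw : ‖w‖ < 1) : invSqrt w ^ 2 = (1 - w)⁻¹ := by
  have h0 := one_sub_ne_zero_of_norm_lt_one hw
  rw [invSqrt, sq, ← Complex.cpow_add _ _ h0]
  norm_num [Complex.cpow_neg_one]

lemma invSqrt_ne_zero {w : ℂ} (hw : ‖w‖ < 1) : invSqrt w ≠ 0 := by
  intro h
  have := invSqrt_sq hw
  rw [h] at this
  exact inv_ne_zero (one_sub_ne_zero_of_norm_lt_one hw) (by simpa using this.symm)

/-- The exponent `-1/2` sends an argument in `(-π, π)` to one in `(-π/2, π/2)`. Consequently the sum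
of two values of the root never vanishes, and the difference quotient has a formula that stays
continuous on the diagonal. -/
lemma invSqrt_re_pos {w : ℂ} (hw : ‖w‖ < 1) : 0 < (invSqrt w).re := by
  have h1 := one_sub_mem_slitPlane hw
  have h0 := Complex.slitPlane_ne_zero h1
  rw [invSqrt, Complex.cpow_def_of_ne_zero h0, Complex.exp_re]
  refine mul_pos (Real.exp_pos _) (Real.cos_pos_of_mem_Ioo ?_)
  have h2 := Complex.neg_pi_lt_arg (1 - w)
  have h3 := Complex.arg_le_pi (1 - w)
  have h4 := (Complex.mem_slitPlane_iff_arg.1 h1).1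
  have h5 : (Complex.log (1 - w) * (-(1 / 2) : ℂ)).im = -((1 - w).arg / 2) := by
    have : (-(1 / 2) : ℂ) = ((-(1 / 2) : ℝ) : ℂ) := by push_cast; rfl
    rw [this, Complex.im_mul_ofReal, Complex.log_im]
    ring
  have h6 : (1 - w).arg < Real.pi := lt_of_le_of_ne h3 h4
  rw [h5]
  constructor <;> linarith

lemma invSqrt_sq_sub_one {w : ℂ} (hw : ‖w‖ < 1) : invSqrt w ^ 2 - 1 = w * invSqrt w ^ 2 := by
  rw [invSqrt_sq hw]
  have := one_sub_ne_zero_of_norm_lt_one hw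
  field_simp
  ring

lemma hasDerivAt_invSqrt {w : ℂ} (hw : ‖w‖ < 1) :
    HasDerivAt invSqrt (invSqrt w ^ 3 / 2) w := by
  have h0 := one_sub_ne_zero_of_norm_lt_one hw
  have h1 : HasDerivAt (fun z : ℂ => 1 - z) (-1) w := by
    simpa using (hasDerivAt_id w).const_sub 1
  have h2 := h1.cpow_const (c := (-(1 / 2) : ℂ)) (one_sub_mem_slitPlane hw)
  refine h2.congr_deriv ?_
  have h3 : (1 - w) ^ (-(1 / 2) - 1 : ℂ) = invSqrt w * (1 - w)⁻¹ := by
    rw [Complex.cpow_sub _ _ h0, Complex.cpow_one, div_eq_mul_inv, invSqrt]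
  rw [h3, ← invSqrt_sq hw]
  ring

lemma continuousOn_invSqrt : ContinuousOn invSqrt (Metric.ball 0 1) := fun w hw =>
  (hasDerivAt_invSqrt (by simpa using hw)).continuousAt.continuousWithinAt

/-- The difference quotient of `invSqrt`. -/
noncomputable def invSqrtSlope (w z : ℂ) : ℂ :=
  invSqrt w ^ 2 * invSqrt z ^ 2 / (invSqrt w + invSqrt z)

lemma invSqrt_add_ne_zero {w z : ℂ} (hw : ‖w‖ < 1) (hz : ‖z‖ < 1) :
    invSqrt w + invSqrt z ≠ 0 := by
  intro h
  have := congrArg Complex.re h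
  have h1 := invSqrt_re_pos hw
  have h2 := invSqrt_re_pos hz
  simp at this
  linarith

lemma invSqrt_sub {w z : ℂ} (hw : ‖w‖ < 1) (hz : ‖z‖ < 1) :
    invSqrt z - invSqrt w = (z - w) * invSqrtSlope w z := by
  have h := invSqrt_add_ne_zero hw hz
  have h1 := one_sub_ne_zero_of_norm_lt_one hw
  have h2 := one_sub_ne_zero_of_norm_lt_one hz
  rw [invSqrtSlope, mul_div_assoc', eq_div_iff h]
  have : (invSqrt z - invSqrt w) * (invSqrt w + invSqrt z) = invSqrt z ^ 2 - invSqrt w ^ 2 := by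
    ring
  rw [this, invSqrt_sq hw, invSqrt_sq hz]
  field_simp
  ring

/-- Bounds for `invSqrt` and its difference quotient on a disc. -/
lemma exists_invSqrt_bound {R : ℝ} (hR : R < 1) : ∃ M : ℝ, 1 ≤ M ∧
    (∀ w : ℂ, ‖w‖ ≤ R → ‖invSqrt w‖ ≤ M) ∧
    ∀ w z : ℂ, ‖w‖ ≤ R → ‖z‖ ≤ R → ‖invSqrtSlope w z‖ ≤ M := by
  have hsub : Metric.closedBall (0 : ℂ) R ⊆ Metric.ball 0 1 := Metric.closedBall_subset_ball hR
  have hc := isCompact_closedBall (0 : ℂ) R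
  obtain ⟨M₁, h₁⟩ := hc.exists_bound_of_continuousOn (continuousOn_invSqrt.mono hsub)
  have hcont : ContinuousOn (fun p : ℂ × ℂ => invSqrtSlope p.1 p.2)
      (Metric.closedBall (0 : ℂ) R ×ˢ Metric.closedBall (0 : ℂ) R) := by
    have c1 : ContinuousOn (fun p : ℂ × ℂ => invSqrt p.1)
        (Metric.closedBall (0 : ℂ) R ×ˢ Metric.closedBall (0 : ℂ) R) :=
      continuousOn_invSqrt.comp continuousOn_fst fun p hp => hsub hp.1
    have c2 : ContinuousOn (fun p : ℂ × ℂ => invSqrt p.2)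
        (Metric.closedBall (0 : ℂ) R ×ˢ Metric.closedBall (0 : ℂ) R) :=
      continuousOn_invSqrt.comp continuousOn_snd fun p hp => hsub hp.2
    refine ((c1.pow 2).mul (c2.pow 2)).div (c1.add c2) fun p hp => ?_
    exact invSqrt_add_ne_zero (by simpa using hsub hp.1) (by simpa using hsub hp.2)
  obtain ⟨M₂, h₂⟩ := (hc.prod hc).exists_bound_of_continuousOn hcont
  refine ⟨max 1 (max M₁ M₂), le_max_left _ _, fun w hw => ?_, fun w z hw hz => ?_⟩
  · exact (h₁ w (by simpa using hw)).trans ((le_max_left _ _).trans (le_max_right _ _))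
  · exact (h₂ (w, z) ⟨by simpa using hw, by simpa using hz⟩).trans
      ((le_max_right _ _).trans (le_max_right _ _))

/-- The product is the falling factorial of `-1/2`; this matches `b_k` with the binomial series of
`(1 + y)^(-1/2)` at `y = -w`. -/
lemma cycleB_eq_choose (k : ℕ) : cycleB k = (-1) ^ k * Ring.choose (-(1 / 2) : ℂ) k := by
  have h := Ring.descPochhammer_eq_factorial_smul_choose (-(1 / 2) : ℂ) k
  have h' : (descPochhammer ℤ k).smeval (-(1 / 2) : ℂ) =
      ∏ j ∈ Finset.range k, (-(1 / 2) - (j : ℂ)) := by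
    induction k with
    | zero => simp
    | succ n ih =>
      rw [Finset.prod_range_succ, ← ih (Ring.descPochhammer_eq_factorial_smul_choose _ n)]
      simp [descPochhammer_succ_right, Polynomial.smeval_mul, Polynomial.smeval_natCast]
  have hk : (k.factorial : ℂ) ≠ 0 := by exact_mod_cast k.factorial_ne_zero
  rw [cycleB, ← h', h, nsmul_eq_mul]
  field_simp

lemma hasSum_invSqrt {w : ℂ} (hw : ‖w‖ < 1) : HasSum (fun k => cycleB k * w ^ k) (invSqrt w) := by
  have h := (Complex.one_add_cpow_hasFPowerSeriesOnBall_zero (a := (-(1 / 2) : ℂ))).hasSum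
    (y := -w) (by simpa [Metric.mem_eball, edist_eq_enorm_sub, enorm_eq_nnnorm] using
      (by exact_mod_cast hw : ‖w‖₊ < 1))
  simp only [binomialSeries_apply, List.ofFn_const, List.prod_replicate, smul_eq_mul] at h
  have h1 : (fun k => cycleB k * w ^ k) = fun k => Ring.choose (-(1 / 2) : ℂ) k * (-w) ^ k := by
    ext k
    rw [cycleB_eq_choose, neg_pow w]
    ring
  rw [h1, invSqrt]
  simpa [← sub_eq_add_neg] using h

lemma cycleB_ne_zero (k : ℕ) : cycleB k ≠ 0 := by
  have hk : (k.factorial : ℂ) ≠ 0 := by exact_mod_cast k.factorial_ne_zero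
  refine div_ne_zero (mul_ne_zero (pow_ne_zero _ (by norm_num)) ?_) hk
  refine Finset.prod_ne_zero_iff.2 fun j _ h => ?_
  have := congrArg Complex.re h
  simp at this
  have : (0 : ℝ) ≤ j := j.cast_nonneg
  linarith

lemma cycleC_ne_zero {m : ℕ} (hm : 0 < m) : cycleC m ≠ 0 := by
  have : (m : ℂ) ≠ 0 := by exact_mod_cast hm.ne'
  have : (Real.pi : ℂ) ≠ 0 := by exact_mod_cast Real.pi_ne_zero
  have := cycleB_ne_zero m
  simp [cycleC, *]

/-! ### The foliation as a differential equation in the chart -/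

/-- The factor `1 + a ε y` in `dH + ε (ω₁ + a ω₂)`, in the chart. -/
noncomputable def cycleDen (a ε : ℂ) (t : ℝ) (w : ℂ) : ℂ :=
  1 + a * ε * Real.sin t * invSqrt w

/-- `w` solves, on `[0, T]`, the differential equation of the foliation in the chart. -/
def IsCycleSolution (a ε : ℂ) (T : ℝ) (w : ℝ → ℂ) : Prop :=
  ∀ t ∈ Set.Icc (0 : ℝ) T, ‖w t‖ < 1 ∧ cycleDen a ε t (w t) ≠ 0 ∧
    HasDerivWithinAt w (ε * w t / cycleDen a ε t (w t)) (Set.Icc 0 T) t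

lemma hasFDerivAt_cycleH (p : ℂ × ℂ) :
    HasFDerivAt cycleH ((2 * p.1) • ContinuousLinearMap.fst ℂ ℂ ℂ +
      (2 * p.2) • ContinuousLinearMap.snd ℂ ℂ ℂ) p := by
  have h1 := (hasFDerivAt_fst (𝕜 := ℂ) (p := p)).pow 2
  have h2 := (hasFDerivAt_snd (𝕜 := ℂ) (p := p)).pow 2
  refine (h1.add h2).congr_fderiv ?_
  ext <;> simp

lemma cycleForm_apply (a ε : ℂ) (p v : ℂ × ℂ) : cycleForm a ε p v =
    2 * (p.1 * v.1 + p.2 * v.2) * (1 + a * ε * p.2) +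
      ε * (cycleH p - 1) * (p.2 * v.1 - p.1 * v.2) := by
  simp only [cycleForm, cycleOmega1, cycleOmega2, (hasFDerivAt_cycleH p).fderiv]
  simp
  ring

lemma cycleChart_eq (z w : ℂ) :
    cycleChart z w = (invSqrt w * Complex.cos z, invSqrt w * Complex.sin z) := rfl

lemma cycleH_cycleChart (z : ℂ) {w : ℂ} (hw : ‖w‖ < 1) :
    cycleH (cycleChart z w) = (1 - w)⁻¹ := by
  rw [cycleH, cycleChart_eq, ← invSqrt_sq hw]
  linear_combination invSqrt w ^ 2 * Complex.sin_sq_add_cos_sq z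

/-- On the radial vector `ω₁` vanishes, and the form takes the value `2 ρ²` times the denominator,
where `ρ = invSqrt w`. -/
lemma cycleForm_cycleChart_ne_zero {a ε : ℂ} {t : ℝ} {w : ℂ} (hw : ‖w‖ < 1)
    (h : cycleDen a ε t w ≠ 0) : cycleForm a ε (cycleChart t w) ≠ 0 := by
  intro h0
  have h1 := congrArg (fun L : (ℂ × ℂ) →L[ℂ] ℂ => L (cycleChart t w)) h0
  have h2 := cycleForm_apply a ε (cycleChart t w) (cycleChart t w)
  simp only [zero_apply] at h1
  rw [h1, cycleChart_eq] at h2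
  have h3 : 2 * invSqrt w ^ 2 * cycleDen a ε t w = 0 := by
    rw [cycleDen, Complex.ofReal_sin]
    linear_combination -h2 - 2 * invSqrt w ^ 2 * (1 + a * ε * Complex.sin t * invSqrt w) *
      Complex.sin_sq_add_cos_sq (t : ℂ)
  simp [invSqrt_ne_zero hw, h] at h3

/-- The velocity of `t ↦ f(t, w t)`, if `w' = d`. -/
noncomputable def cycleVelocity (t : ℝ) (w d : ℂ) : ℂ × ℂ :=
  (invSqrt w ^ 3 / 2 * d * Complex.cos t - invSqrt w * Complex.sin t,
    invSqrt w ^ 3 / 2 * d * Complex.sin t + invSqrt w * Complex.cos t)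

lemma hasDerivWithinAt_cycleChart {w : ℝ → ℂ} {d : ℂ} {s : Set ℝ} {t : ℝ} (hw : ‖w t‖ < 1)
    (h : HasDerivWithinAt w d s t) :
    HasDerivWithinAt (fun x : ℝ => cycleChart x (w x)) (cycleVelocity t (w t) d) s t := by
  have h1 : HasDerivWithinAt (fun x => invSqrt (w x)) (invSqrt (w t) ^ 3 / 2 * d) s t :=
    (hasDerivAt_invSqrt hw).comp_hasDerivWithinAt t h
  have h2 : HasDerivWithinAt (fun x : ℝ => Complex.cos x) (-Complex.sin t) s t :=
    (Complex.hasDerivAt_cos (t : ℂ)).comp_ofReal.hasDerivWithinAt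
  have h3 : HasDerivWithinAt (fun x : ℝ => Complex.sin x) (Complex.cos t) s t :=
    (Complex.hasDerivAt_sin (t : ℂ)).comp_ofReal.hasDerivWithinAt
  refine ((h1.mul h2).prodMk (h1.mul h3)).congr_deriv ?_
  simp only [cycleVelocity, Prod.mk.injEq, and_true]
  ring

/-- With `ρ = invSqrt w`, the radial part of the velocity contributes `ρ · ρ³ d` through `dH`, and
the angular part contributes `-ρ²` times `ε (H - 1) = ε w ρ²`. -/
lemma cycleForm_cycleVelocity (a ε : ℂ) (t : ℝ) {w : ℂ} (d : ℂ) (hw : ‖w‖ < 1) :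
    cycleForm a ε (cycleChart t w) (cycleVelocity t w d) =
      invSqrt w ^ 4 * (d * cycleDen a ε t w - ε * w) := by
  have h1 := invSqrt_sq_sub_one hw
  rw [cycleForm_apply, cycleH_cycleChart _ hw, ← invSqrt_sq hw, h1, cycleChart_eq, cycleVelocity,
    cycleDen, Complex.ofReal_sin]
  linear_combination (invSqrt w ^ 4 * d * (1 + a * ε * Complex.sin t * invSqrt w) -
    ε * w * invSqrt w ^ 4) * Complex.sin_sq_add_cos_sq (t : ℂ)

theorem isCycleLift_iff {a ε : ℂ} {w : ℝ → ℂ} :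
    IsCycleLift a ε w ↔ IsCycleSolution a ε (2 * Real.pi) w := by
  have hu : UniqueDiffOn ℝ (Set.Icc 0 (2 * Real.pi)) := uniqueDiffOn_Icc Real.two_pi_pos
  constructor
  · intro h t ht
    obtain ⟨hw, hf, v, hv, hv0⟩ := h t ht
    -- Only the path in `ℂ²` is known to be differentiable; `w = 1 - 1/H` recovers the
    -- differentiability of `w`.
    have hd : ∃ d, HasDerivWithinAt w d (Set.Icc 0 (2 * Real.pi)) t := by
      have h1 := (((hasFDerivAt_cycleH (cycleChart t (w t))).restrictScalars ℝ)
        |>.comp_hasDerivWithinAt t hv).inv (by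
          simp [cycleH_cycleChart _ hw, one_sub_ne_zero_of_norm_lt_one hw])
      refine ⟨_, (h1.const_sub 1).congr (fun s hs => ?_) ?_⟩
      · simp [cycleH_cycleChart _ (h s hs).1]
      · simp [cycleH_cycleChart _ hw]
    obtain ⟨d, hd⟩ := hd
    have hvd := (hu t ht).eq_deriv _ hv (hasDerivWithinAt_cycleChart hw hd)
    rw [hvd, cycleForm_cycleVelocity _ _ _ _ hw] at hv0
    have h1 : d * cycleDen a ε t (w t) = ε * w t := by
      have := (mul_eq_zero.1 hv0).resolve_left (pow_ne_zero _ (invSqrt_ne_zero hw))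
      linear_combination this
    -- If the denominator vanished, tangency would force `ε w = 0`, and then the whole form would be
    -- zero: the point would be singular.
    have h2 : cycleDen a ε t (w t) ≠ 0 := by
      intro h0
      apply hf
      rw [h0, mul_zero] at h1
      refine ContinuousLinearMap.ext fun v => ?_
      rw [cycleDen, Complex.ofReal_sin] at h0
      rw [cycleForm_apply, cycleH_cycleChart _ hw, ← invSqrt_sq hw, invSqrt_sq_sub_one hw,
        cycleChart_eq, zero_apply]
      linear_combination 2 * (invSqrt (w t) * Complex.cos t * v.1 +
        invSqrt (w t) * Complex.sin t * v.2) * h0 - invSqrt (w t) ^ 2 *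
        (invSqrt (w t) * Complex.sin t * v.1 - invSqrt (w t) * Complex.cos t * v.2) * h1
    refine ⟨hw, h2, hd.congr_deriv ?_⟩
    rw [eq_div_iff h2, h1]
  · intro h t ht
    obtain ⟨hw, h0, hd⟩ := h t ht
    refine ⟨hw, cycleForm_cycleChart_ne_zero hw h0, _, hasDerivWithinAt_cycleChart hw hd, ?_⟩
    rw [cycleForm_cycleVelocity _ _ _ _ hw, div_mul_cancel₀ _ h0]
    ring

/-! ### Differences of solutions -/

/-- The difference quotient in `w` of the vector field `ε w / (1 + a ε sin t (1 - w)^(-1/2))`. -/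
noncomputable def cycleSlope (a ε : ℂ) (t : ℝ) (w z : ℂ) : ℂ :=
  ε * (cycleDen a ε t w - w * (a * ε * Real.sin t * invSqrtSlope w z)) /
    (cycleDen a ε t w * cycleDen a ε t z)

lemma cycleField_sub {a ε : ℂ} {t : ℝ} {w z : ℂ} (hw : ‖w‖ < 1) (hz : ‖z‖ < 1)
    (hw0 : cycleDen a ε t w ≠ 0) (hz0 : cycleDen a ε t z ≠ 0) :
    ε * z / cycleDen a ε t z - ε * w / cycleDen a ε t w = cycleSlope a ε t w z * (z - w) := by
  have h : cycleDen a ε t z =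
      cycleDen a ε t w + a * ε * Real.sin t * ((z - w) * invSqrtSlope w z) := by
    rw [← invSqrt_sub hw hz, cycleDen, cycleDen]
    ring
  rw [cycleSlope, div_sub_div _ _ hz0 hw0, div_mul_eq_mul_div, mul_comm (cycleDen a ε t z)]
  congr 1
  · rw [h]
    ring
  · ring

lemma IsCycleSolution.continuousOn {a ε : ℂ} {T : ℝ} {w : ℝ → ℂ} (h : IsCycleSolution a ε T w) :
    ContinuousOn w (Set.Icc 0 T) := fun t ht => (h t ht).2.2.continuousWithinAt

lemma continuousOn_invSqrt_comp {X : Type*} [TopologicalSpace X] {s : Set X} {w : X → ℂ}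
    (hw : ContinuousOn w s) (h1 : ∀ x ∈ s, ‖w x‖ < 1) :
    ContinuousOn (fun x => invSqrt (w x)) s :=
  continuousOn_invSqrt.comp hw fun x hx => by simpa using h1 x hx

lemma continuousOn_cycleSlope {a ε : ℂ} {X : Type*} [TopologicalSpace X] {s : Set X} {τ : X → ℝ}
    {w z : X → ℂ} (hτ : ContinuousOn τ s) (hw : ContinuousOn w s) (hz : ContinuousOn z s)
    (hw1 : ∀ x ∈ s, ‖w x‖ < 1) (hz1 : ∀ x ∈ s, ‖z x‖ < 1)
    (hw0 : ∀ x ∈ s, cycleDen a ε (τ x) (w x) ≠ 0) (hz0 : ∀ x ∈ s, cycleDen a ε (τ x) (z x) ≠ 0) :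
    ContinuousOn (fun x => cycleSlope a ε (τ x) (w x) (z x)) s := by
  have c1 := continuousOn_invSqrt_comp hw hw1
  have c2 := continuousOn_invSqrt_comp hz hz1
  have cs : ContinuousOn (fun x => ((Real.sin (τ x) : ℝ) : ℂ)) s :=
    (Complex.continuous_ofReal.comp Real.continuous_sin).comp_continuousOn hτ
  have c3 : ContinuousOn (fun x => cycleDen a ε (τ x) (w x)) s := by
    unfold cycleDen; fun_prop
  have c4 : ContinuousOn (fun x => cycleDen a ε (τ x) (z x)) s := by
    unfold cycleDen; fun_prop
  have c5 : ContinuousOn (fun x => invSqrtSlope (w x) (z x)) s :=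
    ((c1.pow 2).mul (c2.pow 2)).div (c1.add c2) fun x hx =>
      invSqrt_add_ne_zero (hw1 x hx) (hz1 x hx)
  exact (continuousOn_const.mul (c3.sub (hw.mul ((continuousOn_const.mul cs).mul c5)))).div
    (c3.mul c4) fun x hx => mul_ne_zero (hw0 x hx) (hz0 x hx)

lemma IsCycleSolution.continuousOn_cycleSlope {a ε : ℂ} {T : ℝ} {w z : ℝ → ℂ}
    (hw : IsCycleSolution a ε T w) (hz : IsCycleSolution a ε T z) :
    ContinuousOn (fun t => cycleSlope a ε t (w t) (z t)) (Set.Icc 0 T) :=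
  _root_.continuousOn_cycleSlope continuousOn_id hw.continuousOn hz.continuousOn
    (fun t ht => (hw t ht).1) (fun t ht => (hz t ht).1) (fun t ht => (hw t ht).2.1)
    fun t ht => (hz t ht).2.1

/-- The integral of a continuous function is an antiderivative on a closed interval. -/
lemma hasDerivWithinAt_integral_Icc {f : ℝ → ℂ} {T t : ℝ} (hf : ContinuousOn f (Set.Icc 0 T))
    (ht : t ∈ Set.Icc 0 T) :
    HasDerivWithinAt (fun s => ∫ x in (0 : ℝ)..s, f x) (f t) (Set.Icc 0 T) t := by
  have : Fact (t ∈ Set.Icc 0 T) := ⟨ht⟩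
  refine intervalIntegral.integral_hasDerivWithinAt_right ?_
    (hf.stronglyMeasurableAtFilter_nhdsWithin measurableSet_Icc t) (hf t ht)
  refine (hf.mono ?_).intervalIntegrable
  rw [Set.uIcc_of_le ht.1]
  exact Set.Icc_subset_Icc_right ht.2

/-- The difference of two solutions. -/
theorem IsCycleSolution.sub_eq {a ε : ℂ} {T : ℝ} {w z : ℝ → ℂ}
    (hw : IsCycleSolution a ε T w) (hz : IsCycleSolution a ε T z) {t : ℝ} (ht : t ∈ Set.Icc 0 T) :
    z t - w t = (z 0 - w 0) * Complex.exp (∫ s in (0 : ℝ)..t, cycleSlope a ε s (w s) (z s)) := by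
  set I : ℝ → ℂ := fun t => ∫ s in (0 : ℝ)..t, cycleSlope a ε s (w s) (z s) with hI
  -- The difference solves a linear equation whose coefficient is the difference quotient of the
  -- field, so this integrating factor makes it constant.
  have hd : ∀ s ∈ Set.Icc 0 T,
      HasDerivWithinAt (fun s => (z s - w s) * Complex.exp (-I s)) 0 (Set.Icc 0 T) s := by
    intro s hs
    have h1 := hasDerivWithinAt_integral_Icc (hw.continuousOn_cycleSlope hz) hs
    have h2 := (((hz s hs).2.2.sub (hw s hs).2.2).mul h1.neg.cexp)
    refine h2.congr_deriv ?_
    rw [cycleField_sub (hw s hs).1 (hz s hs).1 (hw s hs).2.1 (hz s hs).2.1]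
    simp only [Pi.sub_apply, Pi.neg_apply]
    ring
  have h := norm_image_sub_le_of_norm_deriv_le_segment' hd (C := 0) (by simp) t ht
  simp only [zero_mul, norm_le_zero_iff, sub_eq_zero] at h
  have h0 : I 0 = 0 := by simp [hI]
  rw [h0, neg_zero, Complex.exp_zero, mul_one] at h
  rw [← h, mul_assoc, ← Complex.exp_add, neg_add_cancel, Complex.exp_zero, mul_one]

theorem IsCycleSolution.eq_of_eq {a ε : ℂ} {T : ℝ} {w z : ℝ → ℂ}
    (hw : IsCycleSolution a ε T w) (hz : IsCycleSolution a ε T z) (h0 : z 0 = w 0) {t : ℝ}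
    (ht : t ∈ Set.Icc 0 T) : z t = w t := by
  have := hw.sub_eq hz ht
  rwa [h0, sub_self, zero_mul, sub_eq_zero] at this

/-! ### The Poincaré map, its iterates, and holomorphic dependence -/

theorem IsCycleReturn.unique {a ε u v v' : ℂ} (h : IsCycleReturn a ε u v)
    (h' : IsCycleReturn a ε u v') : v = v' := by
  obtain ⟨w, hw, hw0, hwv⟩ := h
  obtain ⟨z, hz, hz0, hzv⟩ := h'
  rw [isCycleLift_iff] at hw hz
  rw [← hwv, ← hzv]
  exact hz.eq_of_eq hw (hw0.trans hz0.symm) ⟨Real.two_pi_pos.le, le_rfl⟩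

theorem IsCycleReturn.cyclePoincare_eq {a ε u v : ℂ} (h : IsCycleReturn a ε u v) :
    cyclePoincare a ε u = v := by
  have hex : ∃ v, IsCycleReturn a ε u v := ⟨v, h⟩
  rw [cyclePoincare, dif_pos hex]
  exact hex.choose_spec.unique h

lemma sin_add_two_pi_mul_nat (t : ℝ) (k : ℕ) : Real.sin (t + 2 * Real.pi * k) = Real.sin t := by
  rw [mul_comm]
  exact Real.sin_add_nat_mul_two_pi t k

/-- A solution on `[0, 2πm]` passes through the successive images under the Poincaré map. -/
theorem IsCycleSolution.isCycleReturn {a ε : ℂ} {m : ℕ} {w : ℝ → ℂ}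
    (hw : IsCycleSolution a ε (2 * Real.pi * m) w) {k : ℕ} (hk : k < m) :
    IsCycleReturn a ε (w (2 * Real.pi * k)) (w (2 * Real.pi * (k + 1 : ℕ))) := by
  refine ⟨fun t => w (t + 2 * Real.pi * k), isCycleLift_iff.2 fun t ht => ?_, by simp, ?_⟩
  · have hk' : (k : ℝ) + 1 ≤ m := by exact_mod_cast hk
    have hmaps : Set.MapsTo (fun t : ℝ => t + 2 * Real.pi * k) (Set.Icc 0 (2 * Real.pi))
        (Set.Icc 0 (2 * Real.pi * m)) := by
      intro s hs
      have h1 : 0 ≤ 2 * Real.pi * k := by positivity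
      have h2 := mul_le_mul_of_nonneg_left hk' Real.two_pi_pos.le
      exact ⟨by linarith [hs.1], by linarith [hs.2]⟩
    obtain ⟨h1, h2, h3⟩ := hw _ (hmaps ht)
    -- The field is `2π`-periodic in `t`, so a shift by whole turns preserves solutions.
    have hden : ∀ z, cycleDen a ε (t + 2 * Real.pi * k) z = cycleDen a ε t z := fun z => by
      rw [cycleDen, cycleDen, sin_add_two_pi_mul_nat]
    rw [hden] at h2 h3
    refine ⟨h1, h2, ?_⟩
    have h4 : HasDerivWithinAt (fun t : ℝ => t + 2 * Real.pi * k) 1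
        (Set.Icc 0 (2 * Real.pi)) t := (hasDerivWithinAt_id t _).add_const _
    have h5 := h3.scomp t h4 hmaps
    rwa [one_smul] at h5
  · change w _ = _
    congr 1
    push_cast
    ring

theorem IsCycleSolution.iterate_cyclePoincare {a ε : ℂ} {m : ℕ} {w : ℝ → ℂ}
    (hw : IsCycleSolution a ε (2 * Real.pi * m) w) {k : ℕ} (hk : k ≤ m) :
    (cyclePoincare a ε)^[k] (w 0) = w (2 * Real.pi * k) := by
  induction k with
  | zero => simp
  | succ n ih =>
    rw [Function.iterate_succ_apply', ih (by omega),
      (hw.isCycleReturn (by omega : n < m)).cyclePoincare_eq]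

/-- Holomorphic dependence of the solutions on the initial value. -/
theorem differentiableOn_of_isCycleSolution {a ε : ℂ} {T K : ℝ} {U : Set ℂ} (hU : IsOpen U)
    {W : ℂ → ℝ → ℂ} (hW : ∀ u ∈ U, IsCycleSolution a ε T (W u)) (hW0 : ∀ u ∈ U, W u 0 = u)
    (hK : ∀ u ∈ U, ∀ v ∈ U, ∀ t ∈ Set.Icc 0 T, ‖cycleSlope a ε t (W u t) (W v t)‖ ≤ K)
    {t : ℝ} (ht : t ∈ Set.Icc 0 T) : DifferentiableOn ℂ (fun u => W u t) U := by
  intro u hu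
  refine DifferentiableAt.differentiableWithinAt
    (HasDerivAt.differentiableAt (f' := Complex.exp (∫ s in (0 : ℝ)..t,
      cycleSlope a ε s (W u s) (W u s))) ?_)
  have hUn : ∀ᶠ v in 𝓝[≠] u, v ∈ U := nhdsWithin_le_nhds (hU.mem_nhds hu)
  have hsub : Set.Icc 0 t ⊆ Set.Icc 0 T := Set.Icc_subset_Icc_right ht.2
  have hIoc : ∀ s ∈ Set.uIoc 0 t, s ∈ Set.Icc 0 T := fun s hs => by
    rw [Set.uIoc_of_le ht.1] at hs
    exact hsub ⟨hs.1.le, hs.2⟩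
  -- A Grönwall-type bound, read off from the exact formula for the difference of two solutions.
  have hlim : ∀ s ∈ Set.Icc 0 T, Filter.Tendsto (fun v => W v s) (𝓝[≠] u) (𝓝 (W u s)) := by
    intro s hs
    rw [tendsto_iff_norm_sub_tendsto_zero]
    have h0 : Filter.Tendsto (fun v : ℂ => ‖v - u‖ * Real.exp (K * s)) (𝓝[≠] u) (𝓝 0) := by
      have : Filter.Tendsto (fun v : ℂ => ‖v - u‖ * Real.exp (K * s)) (𝓝 u)
          (𝓝 (‖u - u‖ * Real.exp (K * s))) := Continuous.tendsto (by fun_prop) u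
      rw [sub_self, norm_zero, zero_mul] at this
      exact this.mono_left nhdsWithin_le_nhds
    refine squeeze_zero' (Filter.Eventually.of_forall fun _ => norm_nonneg _) ?_ h0
    filter_upwards [hUn] with v hv
    rw [(hW u hu).sub_eq (hW v hv) hs, hW0 u hu, hW0 v hv, norm_mul, Complex.norm_exp]
    gcongr
    refine (Complex.re_le_norm _).trans ?_
    have := intervalIntegral.norm_integral_le_of_norm_le_const (a := 0) (b := s) (C := K)
      (f := fun s => cycleSlope a ε s (W u s) (W v s)) fun x hx => by
        rw [Set.uIoc_of_le hs.1] at hx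
        exact hK u hu v hv x ⟨hx.1.le, hx.2.trans hs.2⟩
    simpa [abs_of_nonneg hs.1] using this
  rw [hasDerivAt_iff_tendsto_slope]
  -- The difference quotient in `u` is the exponential of this integral, so dominated convergence
  -- yields the complex derivative.
  have hint : Filter.Tendsto (fun v => ∫ s in (0 : ℝ)..t, cycleSlope a ε s (W u s) (W v s))
      (𝓝[≠] u) (𝓝 (∫ s in (0 : ℝ)..t, cycleSlope a ε s (W u s) (W u s))) := by
    refine intervalIntegral.tendsto_integral_filter_of_dominated_convergence (fun _ => K) ?_ ?_
      intervalIntegrable_const ?_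
    · filter_upwards [hUn] with v hv
      exact (((hW u hu).continuousOn_cycleSlope (hW v hv)).mono hIoc).aestronglyMeasurable
        measurableSet_uIoc
    · filter_upwards [hUn] with v hv
      exact Filter.Eventually.of_forall fun s hs => hK u hu v hv s (hIoc s hs)
    · refine Filter.Eventually.of_forall fun s hs => ?_
      obtain ⟨h1, h2, -⟩ := hW u hu s (hIoc s hs)
      have hi : ContinuousAt invSqrt (W u s) := (hasDerivAt_invSqrt h1).continuousAt
      have hc : ContinuousAt (fun z => cycleSlope a ε s (W u s) z) (W u s) := by
        unfold cycleSlope invSqrtSlope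
        have hd : ContinuousAt (fun z => cycleDen a ε s z) (W u s) := by
          unfold cycleDen; fun_prop
        have hne := invSqrt_add_ne_zero h1 h1
        exact (continuousAt_const.mul (continuousAt_const.sub (continuousAt_const.mul
          (continuousAt_const.mul ((continuousAt_const.mul (hi.pow 2)).div
            (continuousAt_const.add hi) hne))))).div (continuousAt_const.mul hd)
              (mul_ne_zero h2 h2)
      exact hc.tendsto.comp (hlim s (hIoc s hs))
  refine (hint.cexp).congr' ?_
  filter_upwards [hUn, self_mem_nhdsWithin] with v hv hne
  have hne' : v - u ≠ 0 := sub_ne_zero.2 hne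
  rw [slope_def_field, (hW u hu).sub_eq (hW v hv) ht, hW0 u hu, hW0 v hv,
    mul_div_cancel_left₀ _ hne']

/-! ### Existence for small `a` and estimates of the exponent -/

/-- The Picard-Lindelöf theorem, with the solution in the ball where the field is controlled. -/
theorem IsPicardLindelof.exists_mem_closedBall {E : Type*} [NormedAddCommGroup E] [NormedSpace ℝ E]
    [CompleteSpace E] {f : ℝ → E → E} {tmin tmax : ℝ} {t₀ : Set.Icc tmin tmax} {x₀ : E}
    {a L K : NNReal} (hf : IsPicardLindelof f t₀ x₀ a 0 L K) :
    ∃ α : ℝ → E, α t₀ = x₀ ∧ ∀ t ∈ Set.Icc tmin tmax, α t ∈ Metric.closedBall x₀ a ∧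
      HasDerivWithinAt α (f t (α t)) (Set.Icc tmin tmax) t := by
  have hx : x₀ ∈ Metric.closedBall x₀ ((0 : NNReal) : ℝ) := Metric.mem_closedBall_self le_rfl
  obtain ⟨α, hα⟩ := ODE.FunSpace.exists_isFixedPt_next hf hx
  refine ⟨α.compProj, by rw [ODE.FunSpace.compProj_val, ← hα, ODE.FunSpace.next_apply₀],
    fun t ht => ⟨α.compProj_mem_closedBall hf.mul_max_le, ?_⟩⟩
  refine (ODE.hasDerivWithinAt_picard_Icc t₀.2 hf.continuousOn_uncurry
    α.continuous_compProj.continuousOn (fun _ _ => α.compProj_mem_closedBall hf.mul_max_le)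
    x₀ ht).congr_of_mem (fun s hs => ?_) ht
  nth_rw 1 [← hα]
  rw [ODE.FunSpace.compProj_of_mem hs, ODE.FunSpace.next_apply]

/-- The solution that starts at `u` is sought as `t ↦ u exp (ε t + q t)`. -/
noncomputable def cycleAnsatz (ε u : ℂ) (t : ℝ) (q : ℂ) : ℂ := u * Complex.exp (ε * t + q)

/-- The vector field for the exponent `q`. -/
noncomputable def cycleExponentField (a ε u : ℂ) (t : ℝ) (q : ℂ) : ℂ :=
  -(a * ε ^ 2 * Real.sin t * invSqrt (cycleAnsatz ε u t q)) /
    cycleDen a ε t (cycleAnsatz ε u t q)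

lemma cycleAnsatz_eq (ε u : ℂ) (t : ℝ) (q : ℂ) :
    cycleAnsatz ε u t q = u * Complex.exp (ε * t) * Complex.exp q := by
  rw [cycleAnsatz, Complex.exp_add, mul_assoc]

lemma norm_exp_sub_exp_le {p q : ℂ} (hp : ‖p‖ ≤ 1) (hq : ‖q‖ ≤ 1) :
    ‖Complex.exp q - Complex.exp p‖ ≤ 3 * ‖q - p‖ := by
  refine (convex_closedBall (0 : ℂ) 1).norm_image_sub_le_of_norm_hasDerivWithin_le
    (f := Complex.exp) (f' := Complex.exp)
    (fun x _ => (Complex.hasDerivAt_exp x).hasDerivWithinAt) (fun x hx => ?_) (by simpa) (by simpa)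
  rw [Complex.norm_exp]
  have h1 : x.re ≤ 1 := (Complex.re_le_norm x).trans (by simpa using hx)
  exact (Real.exp_le_exp.2 h1).trans (by linarith [Real.exp_one_lt_d9])

lemma norm_cycleAnsatz_sub_le {ε u : ℂ} {t : ℝ} {p q : ℂ} (h : ‖u * Complex.exp (ε * t)‖ ≤ 1)
    (hp : ‖p‖ ≤ 1) (hq : ‖q‖ ≤ 1) :
    ‖cycleAnsatz ε u t q - cycleAnsatz ε u t p‖ ≤ 3 * ‖q - p‖ := by
  rw [cycleAnsatz_eq, cycleAnsatz_eq, ← mul_sub, norm_mul]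
  have := norm_exp_sub_exp_le hp hq
  nlinarith [norm_nonneg (Complex.exp q - Complex.exp p), norm_nonneg (q - p)]

lemma norm_ofReal_sin_le (t : ℝ) : ‖((Real.sin t : ℝ) : ℂ)‖ ≤ 1 := by
  rw [Complex.norm_real, Real.norm_eq_abs]
  exact Real.abs_sin_le_one t

lemma half_le_norm_cycleDen {a ε w : ℂ} {t M E : ℝ} (hM : ‖invSqrt w‖ ≤ M) (hE : ‖ε‖ ≤ E)
    (ha : ‖a‖ * (E * M) ≤ 1 / 2) : 1 / 2 ≤ ‖cycleDen a ε t w‖ := by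
  have h1 : ‖a * ε * Real.sin t * invSqrt w‖ ≤ ‖a‖ * (E * M) := by
    rw [norm_mul, norm_mul, norm_mul, mul_assoc, mul_assoc]
    have := norm_ofReal_sin_le t
    have hE0 := (norm_nonneg _).trans hE
    gcongr
    nlinarith [norm_nonneg (invSqrt w), norm_nonneg ((Real.sin t : ℝ) : ℂ)]
  have h2 := norm_sub_norm_le (1 : ℂ) (-(a * ε * Real.sin t * invSqrt w))
  rw [sub_neg_eq_add, norm_neg, norm_one] at h2
  rw [cycleDen]
  linarith

lemma norm_cycleSlope_le {a ε w z : ℂ} {t M E : ℝ} (hw : ‖w‖ ≤ 1) (hMw : ‖invSqrt w‖ ≤ M)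
    (hMz : ‖invSqrt z‖ ≤ M) (hM : ‖invSqrtSlope w z‖ ≤ M) (hE : ‖ε‖ ≤ E)
    (ha : ‖a‖ * (E * M) ≤ 1 / 2) : ‖cycleSlope a ε t w z‖ ≤ 8 * E := by
  have hE0 := (norm_nonneg _).trans hE
  have hs := norm_ofReal_sin_le t
  have h1 := half_le_norm_cycleDen (t := t) hMw hE ha
  have h2 := half_le_norm_cycleDen (t := t) hMz hE ha
  have key : ∀ y : ℂ, ‖y‖ ≤ M → ‖a * ε * Real.sin t * y‖ ≤ 1 / 2 := fun y hy => by
    refine le_trans ?_ ha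
    rw [norm_mul, norm_mul, norm_mul, mul_assoc, mul_assoc]
    gcongr
    nlinarith [norm_nonneg y, norm_nonneg ((Real.sin t : ℝ) : ℂ)]
  have h3 : ‖cycleDen a ε t w - w * (a * ε * Real.sin t * invSqrtSlope w z)‖ ≤ 2 := by
    refine (norm_sub_le _ _).trans ?_
    have h4 := key _ hM
    have h5 : ‖cycleDen a ε t w‖ ≤ 1 + 1 / 2 := by
      refine (norm_add_le _ _).trans ?_
      rw [norm_one]
      gcongr
      exact key _ hMw
    have h6 : ‖w * (a * ε * Real.sin t * invSqrtSlope w z)‖ ≤ 1 / 2 := by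
      rw [norm_mul]
      exact (mul_le_of_le_one_left (norm_nonneg _) hw).trans h4
    linarith
  rw [cycleSlope, norm_div, norm_mul, norm_mul, div_le_iff₀ (by positivity)]
  have h4 : ‖ε‖ * ‖cycleDen a ε t w - w * (a * ε * Real.sin t * invSqrtSlope w z)‖ ≤ E * 2 := by
    gcongr
  have h5 : 1 / 2 * (1 / 2) ≤ ‖cycleDen a ε t w‖ * ‖cycleDen a ε t z‖ := by gcongr
  nlinarith

lemma norm_cycleExponentField_le {a ε u q : ℂ} {t M E : ℝ}
    (hM : ‖invSqrt (cycleAnsatz ε u t q)‖ ≤ M) (hE : ‖ε‖ ≤ E) (ha : ‖a‖ * (E * M) ≤ 1 / 2) :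
    ‖cycleExponentField a ε u t q‖ ≤ ‖a‖ * (2 * E ^ 2 * M) := by
  have hD := half_le_norm_cycleDen (t := t) hM hE ha
  have hs := norm_ofReal_sin_le t
  have hM0 := (norm_nonneg _).trans hM
  rw [cycleExponentField, norm_div, norm_neg, div_le_iff₀ (by linarith)]
  calc ‖a * ε ^ 2 * Real.sin t * invSqrt (cycleAnsatz ε u t q)‖
      ≤ ‖a‖ * E ^ 2 * 1 * M := by
        rw [norm_mul, norm_mul, norm_mul, norm_pow]
        gcongr
    _ = ‖a‖ * (2 * E ^ 2 * M) * (1 / 2) := by ring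
    _ ≤ _ := by gcongr

/-- The factor 12 is 3, the Lipschitz constant of `exp` on the unit disc, times 4 for two
denominators of norm at least `1/2`. -/
lemma norm_cycleExponentField_sub_le {a ε u p q : ℂ} {t R M E : ℝ} (hR : R < 1)
    (hM : ∀ w : ℂ, ‖w‖ ≤ R → ‖invSqrt w‖ ≤ M)
    (hS : ∀ w z : ℂ, ‖w‖ ≤ R → ‖z‖ ≤ R → ‖invSqrtSlope w z‖ ≤ M) (hE : ‖ε‖ ≤ E)
    (ha : ‖a‖ * (E * M) ≤ 1 / 2) (hu : ‖u * Complex.exp (ε * t)‖ ≤ 1)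
    (hp : ‖p‖ ≤ 1) (hq : ‖q‖ ≤ 1) (hpR : ‖cycleAnsatz ε u t p‖ ≤ R)
    (hqR : ‖cycleAnsatz ε u t q‖ ≤ R) :
    ‖cycleExponentField a ε u t q - cycleExponentField a ε u t p‖ ≤
      ‖a‖ * (12 * E ^ 2 * M) * ‖q - p‖ := by
  have hDp := half_le_norm_cycleDen (t := t) (hM _ hpR) hE ha
  have hDq := half_le_norm_cycleDen (t := t) (hM _ hqR) hE ha
  have hs := norm_ofReal_sin_le t
  have hM0 := (norm_nonneg _).trans (hM _ hpR)
  have hp0 : cycleDen a ε t (cycleAnsatz ε u t p) ≠ 0 := norm_pos_iff.1 (by linarith)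
  have hq0 : cycleDen a ε t (cycleAnsatz ε u t q) ≠ 0 := norm_pos_iff.1 (by linarith)
  have hw := norm_cycleAnsatz_sub_le hu hp hq
  have key : cycleExponentField a ε u t q - cycleExponentField a ε u t p =
      -(a * ε ^ 2 * Real.sin t * ((cycleAnsatz ε u t q - cycleAnsatz ε u t p) *
        invSqrtSlope (cycleAnsatz ε u t p) (cycleAnsatz ε u t q))) /
      (cycleDen a ε t (cycleAnsatz ε u t q) * cycleDen a ε t (cycleAnsatz ε u t p)) := by
    rw [← invSqrt_sub (hpR.trans_lt hR) (hqR.trans_lt hR), cycleExponentField, cycleExponentField,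
      div_sub_div _ _ hq0 hp0]
    congr 1
    rw [cycleDen, cycleDen]
    ring
  rw [key, norm_div, norm_neg, norm_mul (cycleDen a ε t _), div_le_iff₀ (by positivity)]
  have h1 : 1 / 2 * (1 / 2) ≤ ‖cycleDen a ε t (cycleAnsatz ε u t q)‖ *
      ‖cycleDen a ε t (cycleAnsatz ε u t p)‖ := by gcongr
  calc _ ≤ ‖a‖ * E ^ 2 * 1 * (3 * ‖q - p‖ * M) := by
        rw [norm_mul, norm_mul, norm_mul, norm_mul, norm_pow]
        gcongr
        exact hS _ _ hpR hqR
    _ = ‖a‖ * (12 * E ^ 2 * M) * ‖q - p‖ * (1 / 2 * (1 / 2)) := by ring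
    _ ≤ _ := by gcongr

/-- The first-order field puts `q = 0` in the root and replaces the denominator by 1. Each
replacement gives one summand, and both are of second order in `a` once `q = O(a)`. -/
lemma norm_cycleExponentField_sub_firstOrder_le {a ε u q : ℂ} {t R M E : ℝ} (hR : R < 1)
    (hM : ∀ w : ℂ, ‖w‖ ≤ R → ‖invSqrt w‖ ≤ M)
    (hS : ∀ w z : ℂ, ‖w‖ ≤ R → ‖z‖ ≤ R → ‖invSqrtSlope w z‖ ≤ M) (hE : ‖ε‖ ≤ E)
    (ha : ‖a‖ * (E * M) ≤ 1 / 2) (hu : ‖u * Complex.exp (ε * t)‖ ≤ R)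
    (hq : ‖q‖ ≤ 1) (hqR : ‖cycleAnsatz ε u t q‖ ≤ R) :
    ‖cycleExponentField a ε u t q -
        a * -(ε ^ 2 * Real.sin t * invSqrt (u * Complex.exp (ε * t)))‖ ≤
      ‖a‖ * (2 * E ^ 2) * (3 * M * ‖q‖ + ‖a‖ * E * M ^ 2) := by
  have h0 : cycleAnsatz ε u t 0 = u * Complex.exp (ε * t) := by rw [cycleAnsatz, add_zero]
  have hDq := half_le_norm_cycleDen (t := t) (hM _ hqR) hE ha
  have hs := norm_ofReal_sin_le t
  have hM0 := (norm_nonneg _).trans (hM _ hu)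
  have hE0 := (norm_nonneg _).trans hE
  have hq0 : cycleDen a ε t (cycleAnsatz ε u t q) ≠ 0 := norm_pos_iff.1 (by linarith)
  have hw := norm_cycleAnsatz_sub_le (hu.trans hR.le) (p := 0) (by simp) hq
  rw [h0, sub_zero] at hw
  have key : cycleExponentField a ε u t q -
      a * -(ε ^ 2 * Real.sin t * invSqrt (u * Complex.exp (ε * t))) =
      -(a * ε ^ 2 * Real.sin t * ((cycleAnsatz ε u t q - u * Complex.exp (ε * t)) *
        invSqrtSlope (u * Complex.exp (ε * t)) (cycleAnsatz ε u t q) -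
        a * ε * Real.sin t * invSqrt (u * Complex.exp (ε * t)) * invSqrt (cycleAnsatz ε u t q))) /
      cycleDen a ε t (cycleAnsatz ε u t q) := by
    rw [← invSqrt_sub (hu.trans_lt hR) (hqR.trans_lt hR), cycleExponentField,
      div_sub' hq0]
    congr 1
    rw [cycleDen]
    ring
  rw [key, norm_div, norm_neg, div_le_iff₀ (by linarith)]
  calc _ ≤ ‖a‖ * E ^ 2 * 1 * (3 * ‖q‖ * M + ‖a‖ * E * 1 * M * M) := by
        rw [norm_mul, norm_mul, norm_mul, norm_pow]
        gcongr
        refine (norm_sub_le _ _).trans ?_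
        rw [norm_mul, norm_mul, norm_mul, norm_mul, norm_mul]
        gcongr
        · exact hS _ _ hu hqR
        · exact hM _ hu
        · exact hM _ hqR
    _ = ‖a‖ * (2 * E ^ 2) * (3 * M * ‖q‖ + ‖a‖ * E * M ^ 2) * (1 / 2) := by ring
    _ ≤ _ := by gcongr

lemma continuousOn_cycleAnsatz {ε u : ℂ} {q : ℝ → ℂ} {s : Set ℝ} (hq : ContinuousOn q s) :
    ContinuousOn (fun t => cycleAnsatz ε u t (q t)) s := by
  unfold cycleAnsatz
  have := Complex.continuous_ofReal
  fun_prop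

/-- Existence of solutions for small `a`, with uniform estimates of the exponent. -/
theorem exists_cycleSolution {R E T : ℝ} (hR0 : 0 ≤ R) (hR1 : R < 1) (hE : 0 ≤ E) (hT : 0 ≤ T) :
    ∃ C a₀ : ℝ, 0 ≤ C ∧ 0 < a₀ ∧ ∀ a ε : ℂ, ‖a‖ ≤ a₀ → ‖ε‖ ≤ E →
      (∀ (t : ℝ) (w z : ℂ), ‖w‖ ≤ (1 + R) / 2 → ‖z‖ ≤ (1 + R) / 2 →
        ‖cycleSlope a ε t w z‖ ≤ 8 * E) ∧
      ∀ u : ℂ, (∀ t ∈ Set.Icc 0 T, ‖u * Complex.exp (ε * t)‖ ≤ R) →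
      ∃ q : ℝ → ℂ, q 0 = 0 ∧
        IsCycleSolution a ε T (fun t => cycleAnsatz ε u t (q t)) ∧
        ∀ t ∈ Set.Icc 0 T, ‖q t‖ ≤ 1 ∧ ‖q t‖ ≤ C * ‖a‖ ∧
          ‖cycleAnsatz ε u t (q t)‖ ≤ (1 + R) / 2 ∧
          ‖q t - a * ∫ s in (0 : ℝ)..t, -(ε ^ 2 * Real.sin s * invSqrt (u * Complex.exp (ε * s)))‖
            ≤ C * ‖a‖ ^ 2 := by
  set R' := (1 + R) / 2 with hR'
  have hR'1 : R' < 1 := by linarith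
  have hRR' : R ≤ R' := by linarith
  obtain ⟨M, hM1, hM, hS⟩ := exists_invSqrt_bound hR'1
  -- An exponent of norm at most `η` moves the point by at most `3η = R' - R`.
  set η := (1 - R) / 6 with hη
  have hη0 : 0 < η := by rw [hη]; linarith
  have hη1 : η ≤ 1 := by rw [hη]; linarith
  set G := 2 * E ^ 2 * M with hG
  have hG0 : 0 ≤ G := by positivity
  set C₂ := 2 * E ^ 2 * (3 * M * (G * T) + E * M ^ 2) * T with hC₂
  have hC₂0 : 0 ≤ C₂ := by positivity
  have hEM : 0 < E * M + 1 := by positivity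
  have hGT : 0 < G * T + 1 := by positivity
  -- The first bound on `a` keeps the denominators above `1/2`. The second gives `‖a‖ G T ≤ η`,
  -- which lets Picard-Lindelöf cover all of `[0, T]` at once.
  refine ⟨G * T + C₂, min (1 / (2 * (E * M + 1))) (η / (G * T + 1)), by positivity, by positivity,
    fun a ε ha hε => ?_⟩
  have ha1 : ‖a‖ * (E * M) ≤ 1 / 2 := by
    have h1 := (le_div_iff₀ (by positivity)).1 (ha.trans (min_le_left _ _))
    nlinarith [norm_nonneg a]
  have ha2 : ‖a‖ * (G * T) ≤ η := by
    have h1 := (le_div_iff₀ (by positivity)).1 (ha.trans (min_le_right _ _))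
    nlinarith [norm_nonneg a]
  refine ⟨fun t w z hw hz => norm_cycleSlope_le (hw.trans hR'1.le) (hM w hw) (hM z hz)
    (hS w z hw hz) hε ha1, fun u hu => ?_⟩
  have hball : ∀ t ∈ Set.Icc 0 T, ∀ q : ℂ, ‖q‖ ≤ η → ‖cycleAnsatz ε u t q‖ ≤ R' := by
    intro t ht q hq
    have h1 := norm_cycleAnsatz_sub_le ((hu t ht).trans hR1.le) (p := 0) (by simp) (hq.trans hη1)
    have h2 : cycleAnsatz ε u t 0 = u * Complex.exp (ε * t) := by rw [cycleAnsatz, add_zero]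
    rw [h2, sub_zero] at h1
    have h3 := norm_sub_norm_le (cycleAnsatz ε u t q) (u * Complex.exp (ε * t))
    have := hu t ht
    rw [hR', ← sub_nonneg]
    rw [hη] at hq
    linarith
  have hcont : ∀ q : ℝ → ℂ, ContinuousOn q (Set.Icc 0 T) → (∀ t ∈ Set.Icc 0 T, ‖q t‖ ≤ η) →
      ContinuousOn (fun t => cycleExponentField a ε u t (q t)) (Set.Icc 0 T) := by
    intro q hqc hq
    have hc := continuousOn_invSqrt_comp (continuousOn_cycleAnsatz (ε := ε) (u := u) hqc)
      fun t ht => (hball t ht _ (hq t ht)).trans_lt hR'1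
    have hsin : Continuous fun t : ℝ => ((Real.sin t : ℝ) : ℂ) :=
      Complex.continuous_ofReal.comp Real.continuous_sin
    unfold cycleExponentField
    refine ContinuousOn.div ?_ ?_ fun t ht => ?_
    · exact ((continuous_const.mul hsin).continuousOn.mul hc).neg
    · exact continuousOn_const.add ((continuous_const.mul hsin).continuousOn.mul hc)
    · have := half_le_norm_cycleDen (t := t) (hM _ (hball t ht _ (hq t ht))) hε ha1
      exact norm_pos_iff.1 (by linarith)
  have hPL : IsPicardLindelof (cycleExponentField a ε u) (⟨0, ⟨le_rfl, hT⟩⟩ : Set.Icc (0 : ℝ) T)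
      (0 : ℂ) ⟨η, hη0.le⟩ 0 ⟨‖a‖ * G, by positivity⟩ ⟨‖a‖ * (12 * E ^ 2 * M), by positivity⟩ := by
    refine ⟨fun t ht => ?_, fun q hq => ?_, fun t ht q hq => ?_, ?_⟩
    · refine LipschitzOnWith.of_dist_le_mul fun p hp q hq => ?_
      have hp' : ‖p‖ ≤ η := mem_closedBall_zero_iff.1 hp
      have hq' : ‖q‖ ≤ η := mem_closedBall_zero_iff.1 hq
      rw [dist_eq_norm, dist_eq_norm]
      exact norm_cycleExponentField_sub_le hR'1 hM hS hε ha1 ((hu t ht).trans hR1.le)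
        (hq'.trans hη1) (hp'.trans hη1) (hball t ht _ hq') (hball t ht _ hp')
    · exact hcont (fun _ => q) continuousOn_const fun _ _ => mem_closedBall_zero_iff.1 hq
    · exact norm_cycleExponentField_le (hM _ (hball t ht _ (mem_closedBall_zero_iff.1 hq))) hε ha1
    · change ‖a‖ * G * max (T - 0) (0 - 0) ≤ η - 0
      rw [sub_zero, sub_zero, sub_zero, max_eq_left hT, mul_assoc]
      exact ha2
  obtain ⟨q, hq0, hq⟩ := hPL.exists_mem_closedBall
  replace hq0 : q 0 = 0 := hq0
  have hqη : ∀ t ∈ Set.Icc 0 T, ‖q t‖ ≤ η := fun t ht => mem_closedBall_zero_iff.1 (hq t ht).1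
  have hqR : ∀ t ∈ Set.Icc 0 T, ‖cycleAnsatz ε u t (q t)‖ ≤ R' := fun t ht =>
    hball t ht _ (hqη t ht)
  have hqG : ∀ t ∈ Set.Icc 0 T, ‖q t‖ ≤ G * T * ‖a‖ := fun t ht => by
    have h1 := norm_image_sub_le_of_norm_deriv_le_segment' (fun s hs => (hq s hs).2)
      (fun s hs => norm_cycleExponentField_le (hM _ (hqR s (Set.Ico_subset_Icc_self hs))) hε ha1)
      t ht
    rw [hq0, sub_zero, sub_zero] at h1
    refine h1.trans ?_
    rw [mul_comm (G * T), mul_assoc]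
    gcongr
    exact ht.2
  refine ⟨q, hq0, fun t ht => ?_, fun t ht => ⟨(hqη t ht).trans hη1, ?_, hqR t ht, ?_⟩⟩
  · have hden := half_le_norm_cycleDen (t := t) (hM _ (hqR t ht)) hε ha1
    have hden0 : cycleDen a ε t (cycleAnsatz ε u t (q t)) ≠ 0 := norm_pos_iff.1 (by linarith)
    refine ⟨(hqR t ht).trans_lt hR'1, hden0, ?_⟩
    have h1 : HasDerivWithinAt (fun t : ℝ => ε * (t : ℂ)) ε (Set.Icc 0 T) t := by
      simpa using ((hasDerivAt_id t).ofReal_comp.const_mul ε).hasDerivWithinAt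
    have h2 := ((h1.add (hq t ht).2).cexp).const_mul u
    refine h2.congr_deriv ?_
    -- The equation for `w` amounts to `ε + q' = ε / cycleDen`.
    rw [cycleExponentField, eq_div_iff hden0]
    have h3 : u * Complex.exp (ε * t + q t) = cycleAnsatz ε u t (q t) := rfl
    simp only [Pi.add_apply]
    rw [← mul_assoc, h3, mul_assoc, add_mul, div_mul_cancel₀ _ hden0, cycleDen]
    ring
  · exact (hqG t ht).trans (by gcongr; linarith)
  · set k : ℝ → ℂ := fun s => -(ε ^ 2 * Real.sin s * invSqrt (u * Complex.exp (ε * s))) with hk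
    have hkc : ContinuousOn k (Set.Icc 0 T) := by
      have hsin : Continuous fun t : ℝ => ((Real.sin t : ℝ) : ℂ) :=
        Complex.continuous_ofReal.comp Real.continuous_sin
      refine ((continuous_const.mul hsin).continuousOn.mul
        (continuousOn_invSqrt_comp ?_ fun s hs => (hu s hs).trans_lt hR1)).neg
      have := Complex.continuous_ofReal
      fun_prop
    -- Feeding `q = O(a)` back into the field bounds the derivative of the error by `O(a²)`.
    have h1 := norm_image_sub_le_of_norm_deriv_le_segment'
      (fun s hs => (hq s hs).2.sub ((hasDerivWithinAt_integral_Icc hkc hs).const_mul a))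
      (C := ‖a‖ * (2 * E ^ 2) * (3 * M * (G * T * ‖a‖) + ‖a‖ * E * M ^ 2)) (fun s hs => ?_) t ht
    · simp only [Pi.sub_apply, hq0, intervalIntegral.integral_same, mul_zero, sub_zero] at h1
      refine h1.trans ?_
      have h2 : ‖a‖ * (2 * E ^ 2) * (3 * M * (G * T * ‖a‖) + ‖a‖ * E * M ^ 2) * T =
        C₂ * ‖a‖ ^ 2 := by rw [hC₂]; ring
      calc _ ≤ ‖a‖ * (2 * E ^ 2) * (3 * M * (G * T * ‖a‖) + ‖a‖ * E * M ^ 2) * T := by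
            gcongr
            exact ht.2
        _ = C₂ * ‖a‖ ^ 2 := h2
        _ ≤ _ := by
            gcongr
            linarith [mul_nonneg hG0 hT]
    · have hs' := Set.Ico_subset_Icc_self hs
      refine (norm_cycleExponentField_sub_firstOrder_le hR'1 hM hS hε ha1 ((hu s hs').trans hRR')
        ((hqη s hs').trans hη1) (hqR s hs')).trans ?_
      gcongr
      exact hqG s hs'

/-! ### The first-order integral at `ε = i/m` -/

/-- The periods of the exponentials `exp (i k t / m)` on `[0, 2πm]`. -/
lemma integral_exp_two_pi_mul {m : ℕ} (hm : 0 < m) (n : ℤ) :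
    ∫ t in (0 : ℝ)..(2 * Real.pi * m), Complex.exp (n * (Complex.I / m) * t) =
      (if n = 0 then 2 * Real.pi * m else 0 : ℂ) := by
  have hm' : (m : ℂ) ≠ 0 := by exact_mod_cast hm.ne'
  split_ifs with hn
  · simp [hn]
  · have hc : (n : ℂ) * (Complex.I / m) ≠ 0 :=
      mul_ne_zero (by exact_mod_cast hn) (div_ne_zero Complex.I_ne_zero hm')
    rw [integral_exp_mul_complex hc]
    have h1 : (n : ℂ) * (Complex.I / m) * ((2 * Real.pi * m : ℝ) : ℂ) =
        n * (2 * Real.pi * Complex.I) := by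
      push_cast
      field_simp
    rw [h1, Complex.exp_int_mul_two_pi_mul_I]
    simp

/-- Writing `sin` by exponentials gives the frequencies `(k - m)/m` and `(k + m)/m`. The second is
never zero, the first only for `k = m`. -/
lemma integral_sin_mul_exp {m : ℕ} (hm : 0 < m) (k : ℕ) :
    ∫ t in (0 : ℝ)..(2 * Real.pi * m), (Real.sin t : ℂ) * Complex.exp (k * (Complex.I / m) * t) =
      (if k = m then Complex.I * Real.pi * m else 0 : ℂ) := by
  have hm' : (m : ℂ) ≠ 0 := by exact_mod_cast hm.ne'
  have h1 : ∀ t : ℝ, (Real.sin t : ℂ) * Complex.exp (k * (Complex.I / m) * t) =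
      Complex.I / 2 * Complex.exp (((k - m : ℤ) : ℂ) * (Complex.I / m) * t) -
        Complex.I / 2 * Complex.exp (((k + m : ℤ) : ℂ) * (Complex.I / m) * t) := by
    intro t
    have h2 : ((k - m : ℤ) : ℂ) * (Complex.I / m) * t =
        -t * Complex.I + k * (Complex.I / m) * t := by
      push_cast
      field_simp
      ring
    have h3 : ((k + m : ℤ) : ℂ) * (Complex.I / m) * t =
        t * Complex.I + k * (Complex.I / m) * t := by
      push_cast
      field_simp
      ring
    rw [h2, h3, Complex.exp_add, Complex.exp_add, Complex.ofReal_sin, Complex.sin]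
    ring
  have hc : ∀ n : ℤ, Continuous fun t : ℝ =>
      Complex.I / 2 * Complex.exp ((n : ℂ) * (Complex.I / m) * t) := fun n => by
    have := Complex.continuous_ofReal
    fun_prop
  simp_rw [h1]
  rw [intervalIntegral.integral_sub ((hc _).intervalIntegrable _ _)
    ((hc _).intervalIntegrable _ _), intervalIntegral.integral_const_mul,
    intervalIntegral.integral_const_mul, integral_exp_two_pi_mul hm, integral_exp_two_pi_mul hm]
  rw [if_neg (by omega : ¬ ((k : ℤ) + m = 0))]
  by_cases hk : k = m
  · rw [if_pos (by omega), if_pos hk]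
    ring
  · rw [if_neg (by omega), if_neg hk]
    ring

lemma norm_exp_I_div (m : ℕ) (t : ℝ) : ‖Complex.exp (Complex.I / m * t)‖ = 1 := by
  have : Complex.I / m * t = ((t / m : ℝ) : ℂ) * Complex.I := by
    push_cast
    ring
  rw [this, Complex.norm_exp_ofReal_mul_I]

/-- The first order term in `a` of the exponent of the `m`-th iterate of the Poincaré map. -/
theorem integral_firstOrder {m : ℕ} (hm : 0 < m) {u : ℂ} (hu : ‖u‖ < 1) :
    ∫ t in (0 : ℝ)..(2 * Real.pi * m), -((Complex.I / m) ^ 2 * Real.sin t *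
      invSqrt (u * Complex.exp (Complex.I / m * t))) = cycleC m * u ^ m := by
  have hm' : (m : ℂ) ≠ 0 := by exact_mod_cast hm.ne'
  have hun : ∀ t : ℝ, ‖u * Complex.exp (Complex.I / m * t)‖ = ‖u‖ := fun t => by
    rw [norm_mul, norm_exp_I_div, mul_one]
  set F : ℕ → ℝ → ℂ := fun k t => -((Complex.I / m) ^ 2 * cycleB k * u ^ k) *
    ((Real.sin t : ℂ) * Complex.exp (k * (Complex.I / m) * t)) with hF
  have hsum : Summable fun k => ‖cycleB k * u ^ k‖ := (hasSum_invSqrt hu).summable.norm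
  -- The rotation keeps `|u|` fixed, so the Taylor series is dominated uniformly in `t` and may be
  -- integrated term by term.
  have h1 : HasSum (fun k => ∫ t in (0 : ℝ)..(2 * Real.pi * m), F k t)
      (∫ t in (0 : ℝ)..(2 * Real.pi * m), -((Complex.I / m) ^ 2 * Real.sin t *
        invSqrt (u * Complex.exp (Complex.I / m * t)))) := by
    refine intervalIntegral.hasSum_integral_of_dominated_convergence
      (fun k _ => ‖(Complex.I / m) ^ 2‖ * ‖cycleB k * u ^ k‖) (fun k => ?_) (fun k => ?_)
      (Filter.Eventually.of_forall fun _ _ => hsum.mul_left _) intervalIntegrable_const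
      (Filter.Eventually.of_forall fun t _ => ?_)
    · refine Continuous.aestronglyMeasurable ?_
      have := Complex.continuous_ofReal
      fun_prop
    · refine Filter.Eventually.of_forall fun t _ => ?_
      have h2 : (k : ℂ) * (Complex.I / m) * t = Complex.I / m * ((k * t : ℝ) : ℂ) := by
        push_cast
        ring
      rw [hF]
      simp only
      rw [h2, norm_mul _ (_ * Complex.exp _), norm_mul _ (Complex.exp _), norm_exp_I_div, norm_neg,
        mul_assoc, norm_mul _ (cycleB k * _), mul_one]
      exact mul_le_of_le_one_right (by positivity) (norm_ofReal_sin_le t)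
    · have h2 := (hasSum_invSqrt ((hun t).trans_lt hu)).mul_left (-((Complex.I / m) ^ 2 *
        (Real.sin t : ℂ)))
      rw [← neg_mul]
      have h4 : (fun k => F k t) = fun k => -((Complex.I / m) ^ 2 * (Real.sin t : ℂ)) *
          (cycleB k * (u * Complex.exp (Complex.I / m * t)) ^ k) := by
        ext k
        have h3 : (k : ℂ) * (Complex.I / m) * t = k * (Complex.I / m * t) := by ring
        simp only [hF]
        rw [mul_pow, ← Complex.exp_nat_mul, h3]
        ring
      rwa [h4]
  have h2 : ∀ k, ∫ t in (0 : ℝ)..(2 * Real.pi * m), F k t =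
      if k = m then cycleC m * u ^ m else 0 := by
    intro k
    rw [hF, intervalIntegral.integral_const_mul, integral_sin_mul_exp hm]
    split_ifs with hk
    · rw [hk, cycleC, div_pow, Complex.I_sq]
      field_simp
    · simp
  simp_rw [h2] at h1
  exact h1.unique (hasSum_ite_eq m _)

lemma norm_I_div_le_one {m : ℕ} (hm : 0 < m) : ‖Complex.I / (m : ℂ)‖ ≤ 1 := by
  have hm1 : (1 : ℝ) ≤ m := by exact_mod_cast hm
  rw [norm_div, Complex.norm_I, Complex.norm_natCast]
  exact div_le_one_of_le₀ hm1 (by positivity)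

/-- The first order term depends in a Lipschitz way on `ε`. -/
lemma norm_integral_firstOrder_sub_le {m : ℕ} (hm : 0 < m) {ε u : ℂ} {R M : ℝ} (hR : R < 1)
    (hM : ∀ w : ℂ, ‖w‖ ≤ R → ‖invSqrt w‖ ≤ M)
    (hS : ∀ w z : ℂ, ‖w‖ ≤ R → ‖z‖ ≤ R → ‖invSqrtSlope w z‖ ≤ M)
    (huR : ∀ t ∈ Set.Icc 0 (2 * Real.pi * m), ‖u * Complex.exp (ε * t)‖ ≤ R) (hu : ‖u‖ ≤ R)
    (hexp : ∀ t ∈ Set.Icc 0 (2 * Real.pi * m),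
      ‖Complex.exp (ε * t) - Complex.exp (Complex.I / m * t)‖ ≤ 3 * (‖ε - Complex.I / m‖ * t))
    (hε : ‖ε‖ ≤ 2) :
    ‖(∫ s in (0 : ℝ)..(2 * Real.pi * m), -(ε ^ 2 * Real.sin s *
        invSqrt (u * Complex.exp (ε * s)))) - cycleC m * u ^ m‖ ≤
      (4 * M + 12 * M * (2 * Real.pi * m)) * (2 * Real.pi * m) * ‖ε - Complex.I / m‖ := by
  have hκ1 := norm_I_div_le_one hm
  set κ := Complex.I / (m : ℂ) with hκ
  set T := 2 * Real.pi * m with hT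
  set d := ‖ε - κ‖ with hd
  have hd0 : 0 ≤ d := norm_nonneg _
  have hT0 : 0 < T := by rw [hT]; positivity
  have hM0 : 0 ≤ M := (norm_nonneg _).trans (hM u hu)
  rw [← integral_firstOrder hm (hu.trans_lt hR)]
  have hcont : ∀ e : ℂ, (∀ t ∈ Set.Icc 0 T, ‖u * Complex.exp (e * t)‖ ≤ R) →
      IntervalIntegrable (fun s : ℝ => -(e ^ 2 * Real.sin s *
        invSqrt (u * Complex.exp (e * s)))) MeasureTheory.volume 0 T := by
    intro e he
    refine ContinuousOn.intervalIntegrable ?_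
    rw [Set.uIcc_of_le hT0.le]
    have hsin : Continuous fun t : ℝ => ((Real.sin t : ℝ) : ℂ) :=
      Complex.continuous_ofReal.comp Real.continuous_sin
    refine ((continuous_const.mul hsin).continuousOn.mul
      (continuousOn_invSqrt_comp ?_ fun s hs => (he s hs).trans_lt hR)).neg
    have := Complex.continuous_ofReal
    fun_prop
  have hκR : ∀ t ∈ Set.Icc 0 T, ‖u * Complex.exp (κ * t)‖ ≤ R := fun t _ => by
    rwa [norm_mul, norm_exp_I_div, mul_one]
  rw [← intervalIntegral.integral_sub (hcont ε huR) (hcont κ hκR)]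
  have h6 := intervalIntegral.norm_integral_le_of_norm_le_const (a := 0) (b := T)
    (C := (4 * M + 12 * M * T) * d)
    (f := fun s : ℝ => -(ε ^ 2 * Real.sin s * invSqrt (u * Complex.exp (ε * s))) -
      -(κ ^ 2 * Real.sin s * invSqrt (u * Complex.exp (κ * s)))) fun s hs => ?_
  · rw [sub_zero, abs_of_pos hT0] at h6
    refine h6.trans (le_of_eq ?_)
    ring
  · rw [Set.uIoc_of_le hT0.le] at hs
    have hs' : s ∈ Set.Icc 0 T := ⟨hs.1.le, hs.2⟩
    have e1 := huR s hs'
    have e2 := hκR s hs'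
    have e3 : -(ε ^ 2 * Real.sin s * invSqrt (u * Complex.exp (ε * s))) -
        -(κ ^ 2 * Real.sin s * invSqrt (u * Complex.exp (κ * s))) =
        -(Real.sin s * ((ε - κ) * (ε + κ) * invSqrt (u * Complex.exp (ε * s)) + κ ^ 2 *
          (u * (Complex.exp (ε * s) - Complex.exp (κ * s)) *
            invSqrtSlope (u * Complex.exp (κ * s)) (u * Complex.exp (ε * s))))) := by
      rw [mul_sub u, ← invSqrt_sub (e2.trans_lt hR) (e1.trans_lt hR)]
      ring
    have e4 : ‖ε + κ‖ ≤ 4 := (norm_add_le _ _).trans (by linarith)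
    have e5 := hexp s hs'
    have e6 : 3 * (d * s) ≤ 3 * (d * T) := by
      have := mul_le_mul_of_nonneg_left hs.2 hd0
      linarith
    rw [e3, norm_neg, norm_mul]
    refine (mul_le_of_le_one_left (norm_nonneg _) (norm_ofReal_sin_le s)).trans ?_
    refine (norm_add_le _ _).trans ?_
    rw [norm_mul, norm_mul, norm_mul (κ ^ 2), norm_mul, norm_mul u, norm_pow]
    calc _ ≤ d * 4 * M + 1 ^ 2 * (1 * (3 * (d * T)) * M) := by
          gcongr
          · exact hM _ e1
          · linarith
          · exact e5.trans e6
          · exact hS _ _ e2 e1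
      _ ≤ _ := by
          have : 0 ≤ d * T * M := by positivity
          nlinarith

/-! ### Expansion of the iterates -/

/-- The iterates of the Poincaré map near `a = 0`, `ε = i / m`. -/
theorem exists_iterate_cyclePoincare {m : ℕ} (hm : 0 < m) {R : ℝ} (hR0 : 0 ≤ R) (hR1 : R < 1) :
    ∃ C a₀ : ℝ, 0 ≤ C ∧ 0 < a₀ ∧ ∀ a ε : ℂ, ‖a‖ ≤ a₀ → ‖ε - Complex.I / m‖ ≤ a₀ →
      (∀ u : ℂ, ‖u‖ ≤ R →
        (∀ k < m, IsCycleReturn a ε ((cyclePoincare a ε)^[k] u) ((cyclePoincare a ε)^[k + 1] u)) ∧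
        (∀ k ≤ m, ‖(cyclePoincare a ε)^[k] u -
          u * Complex.exp (2 * Real.pi * k * (Complex.I / m))‖ ≤
            C * (‖a‖ + ‖ε - Complex.I / m‖) * ‖u‖) ∧
        ‖(cyclePoincare a ε)^[m] u -
          u * (1 + 2 * Real.pi * m * (ε - Complex.I / m) + a * cycleC m * u ^ m)‖ ≤
            C * (‖a‖ + ‖ε - Complex.I / m‖) ^ 2 * ‖u‖) ∧
      ∀ k ≤ m, DifferentiableOn ℂ (cyclePoincare a ε)^[k] (Metric.ball 0 R) := by
  set κ := Complex.I / (m : ℂ) with hκ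
  set T := 2 * Real.pi * m with hT
  set R₁ := (1 + R) / 2 with hR₁
  have hR₁0 : 0 ≤ R₁ := by rw [hR₁]; linarith
  have hR₁1 : R₁ < 1 := by rw [hR₁]; linarith
  have hT0 : 0 < T := by rw [hT]; positivity
  have hκ1 : ‖κ‖ ≤ 1 := norm_I_div_le_one hm
  obtain ⟨M, hM1, hM, hS⟩ := exists_invSqrt_bound hR₁1
  obtain ⟨C, a₁, hC0, ha₁, hsol⟩ := exists_cycleSolution hR₁0 hR₁1 zero_le_two hT0.le
  -- For `ε` near `i/m` the factor `exp(εt)` has norm at most `1 + 3η` on `[0, T]`, and `R (1 + 3η)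
  -- ≤ R₁`.
  set η := (1 - R) / 6 with hη
  have hη0 : 0 < η := by rw [hη]; linarith
  have hη1 : η ≤ 1 := by rw [hη]; linarith
  set C' := (4 * M + 12 * M * T) * T with hC'
  have hM0 : 0 ≤ M := by linarith
  have hC'0 : 0 ≤ C' := by positivity
  -- The first summand serves all iterates `k ≤ m`. In the quadratic estimate, `(T + C)²` comes from
  -- the remainder of `exp`, `C` from the exponent, and `C'` from moving `ε` away from `i/m`.
  refine ⟨3 * (T + C) + ((T + C) ^ 2 + C + C'), min 1 (min a₁ (min (η / T) (1 / (2 * (T + C))))),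
    by positivity, by positivity, fun a ε ha hε => ?_⟩
  set d := ‖ε - κ‖ with hd
  have hd0 : 0 ≤ d := norm_nonneg _
  have ha0 : 0 ≤ ‖a‖ := norm_nonneg _
  have hd1 : d ≤ 1 := hε.trans (min_le_left _ _)
  have haa : ‖a‖ ≤ a₁ := ha.trans ((min_le_right _ _).trans (min_le_left _ _))
  have hdT : d * T ≤ η := (le_div_iff₀ hT0).1
    (hε.trans ((min_le_right _ _).trans ((min_le_right _ _).trans (min_le_left _ _))))
  have hsmall : (T + C) * (‖a‖ + d) ≤ 1 := by
    have h1 := (le_div_iff₀ (by positivity)).1 (ha.trans ((min_le_right _ _).trans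
      ((min_le_right _ _).trans (min_le_right _ _))))
    have h2 := (le_div_iff₀ (by positivity)).1 (hε.trans ((min_le_right _ _).trans
      ((min_le_right _ _).trans (min_le_right _ _))))
    nlinarith
  have hε2 : ‖ε‖ ≤ 2 := by
    have h1 := norm_sub_norm_le ε κ
    linarith
  obtain ⟨hslope, hsol⟩ := hsol a ε haa hε2
  have hexp : ∀ t ∈ Set.Icc 0 T, ‖Complex.exp (ε * t) - Complex.exp (κ * t)‖ ≤ 3 * (d * t) := by
    intro t ht
    have h1 : ‖(ε - κ) * t‖ = d * t := by
      rw [norm_mul, Complex.norm_real, Real.norm_of_nonneg ht.1]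
    have h2 : d * t ≤ 1 := (mul_le_mul_of_nonneg_left ht.2 hd0).trans (hdT.trans hη1)
    have h3 := norm_exp_sub_exp_le (p := 0) (by simp) (h1.trans_le h2)
    have h4 : Complex.exp (ε * t) - Complex.exp (κ * t) =
        Complex.exp (κ * t) * (Complex.exp ((ε - κ) * t) - Complex.exp 0) := by
      rw [mul_sub, ← Complex.exp_add, ← Complex.exp_add]
      ring_nf
    rw [h4, norm_mul, norm_exp_I_div, one_mul, ← h1]
    simpa using h3
  have huR : ∀ u : ℂ, ‖u‖ ≤ R → ∀ t ∈ Set.Icc 0 T, ‖u * Complex.exp (ε * t)‖ ≤ R₁ := by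
    intro u hu t ht
    have h1 := norm_sub_norm_le (Complex.exp (ε * t)) (Complex.exp (κ * t))
    have h2 := hexp t ht
    have h3 := mul_le_mul_of_nonneg_left ht.2 hd0
    rw [norm_exp_I_div] at h1
    have h4 : ‖Complex.exp (ε * t)‖ ≤ 1 + 3 * η := by linarith
    rw [norm_mul]
    calc _ ≤ R * (1 + 3 * η) := by gcongr
      _ ≤ R₁ := by rw [hR₁, hη]; nlinarith
  choose! q hq0 hqs hq using fun u (hu : ‖u‖ ≤ R) => hsol u (huR u hu)
  have hkT : ∀ k : ℕ, k ≤ m → 2 * Real.pi * k ∈ Set.Icc 0 T := by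
    intro k hk
    have hk' : (k : ℝ) ≤ m := by exact_mod_cast hk
    refine ⟨by positivity, ?_⟩
    rw [hT]
    gcongr
  have hit : ∀ u : ℂ, ‖u‖ ≤ R → ∀ k ≤ m, (cyclePoincare a ε)^[k] u =
      cycleAnsatz ε u (2 * Real.pi * k) (q u (2 * Real.pi * k)) := by
    intro u hu k hk
    have h1 := (hqs u hu).iterate_cyclePoincare hk
    simp only [hq0 u hu] at h1
    rw [← h1]
    simp [cycleAnsatz]
  refine ⟨fun u hu => ?_, fun k hk => ?_⟩
  -- `x k` is the logarithmic deviation of the `k`-th iterate from the exact rotation.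
  · set x : ℕ → ℂ := fun k => (ε - κ) * (2 * Real.pi * k : ℝ) + q u (2 * Real.pi * k) with hx
    have hxe : ∀ k ≤ m, (cyclePoincare a ε)^[k] u =
        u * Complex.exp (2 * Real.pi * k * κ) * Complex.exp (x k) := by
      intro k hk
      rw [hit u hu k hk, cycleAnsatz, mul_assoc u, ← Complex.exp_add, hx]
      congr 2
      push_cast
      ring
    have hxn : ∀ k ≤ m, ‖x k‖ ≤ (T + C) * (‖a‖ + d) := by
      intro k hk
      have h1 := ((hq u hu _ (hkT k hk)).2).1
      have h2 : ‖(ε - κ) * (2 * Real.pi * k : ℝ)‖ ≤ d * T := by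
        rw [norm_mul, Complex.norm_real, Real.norm_of_nonneg (hkT k hk).1]
        gcongr
        exact (hkT k hk).2
      refine (norm_add_le _ _).trans ((add_le_add h2 h1).trans ?_)
      nlinarith [mul_nonneg hT0.le ha0, mul_nonneg hC0 hd0]
    have hek : ∀ k : ℕ, ‖u * Complex.exp (2 * Real.pi * k * κ)‖ = ‖u‖ := by
      intro k
      have h1 : 2 * Real.pi * k * κ = κ * ((2 * Real.pi * k : ℝ) : ℂ) := by
        push_cast
        ring
      rw [norm_mul, h1, norm_exp_I_div, mul_one]
    refine ⟨fun k hk => ?_, fun k hk => ?_, ?_⟩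
    · rw [hit u hu k hk.le, hit u hu (k + 1) hk]
      exact (hqs u hu).isCycleReturn hk
    · rw [hxe k hk]
      have h1 := norm_exp_sub_exp_le (p := 0) (by simp) ((hxn k hk).trans hsmall)
      rw [Complex.exp_zero, sub_zero] at h1
      have h2 : u * Complex.exp (2 * Real.pi * k * κ) * Complex.exp (x k) -
          u * Complex.exp (2 * Real.pi * k * κ) =
          u * Complex.exp (2 * Real.pi * k * κ) * (Complex.exp (x k) - 1) := by ring
      rw [h2, norm_mul, hek, mul_comm]
      have h3 : 0 ≤ ((T + C) ^ 2 + C + C') * (‖a‖ + d) := by positivity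
      gcongr
      linarith [hxn k hk]
    · have h1 := Complex.norm_exp_sub_one_sub_id_le ((hxn m le_rfl).trans hsmall)
      have h2 : Complex.exp (2 * Real.pi * m * κ) = 1 := by
        have hm' : (m : ℂ) ≠ 0 := by exact_mod_cast hm.ne'
        have : 2 * Real.pi * m * κ = 2 * Real.pi * Complex.I := by
          rw [hκ]
          field_simp
        rw [this, Complex.exp_two_pi_mul_I]
      have h3 : ‖q u T - a * (cycleC m * u ^ m)‖ ≤ C * ‖a‖ ^ 2 + ‖a‖ * (C' * d) := by
        have h4 := ((hq u hu T ⟨hT0.le, le_rfl⟩).2).2.2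
        set J := ∫ s in (0 : ℝ)..T, -(ε ^ 2 * Real.sin s * invSqrt (u * Complex.exp (ε * s)))
        have h5 : ‖J - cycleC m * u ^ m‖ ≤ C' * d :=
          norm_integral_firstOrder_sub_le hm hR₁1 hM hS (huR u hu)
            (hu.trans (by rw [hR₁]; linarith)) hexp hε2
        have h6 : q u T - a * (cycleC m * u ^ m) = (q u T - a * J) +
            a * (J - cycleC m * u ^ m) := by ring
        rw [h6]
        refine (norm_add_le _ _).trans (add_le_add h4 ?_)
        rw [norm_mul]
        gcongr
      have h4 : u * Complex.exp (x m) -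
          u * (1 + 2 * Real.pi * m * (ε - κ) + a * cycleC m * u ^ m) =
          u * ((Complex.exp (x m) - 1 - x m) + (q u T - a * (cycleC m * u ^ m))) := by
        have h5 : x m = 2 * Real.pi * m * (ε - κ) + q u T := by
          rw [hx, hT]
          push_cast
          ring
        rw [h5]
        ring
      rw [hxe m le_rfl, h2, mul_one, h4, norm_mul, mul_comm]
      refine mul_le_mul_of_nonneg_right ?_ (norm_nonneg u)
      refine (norm_add_le _ _).trans ((add_le_add h1 h3).trans ?_)
      have h5 : ‖x m‖ ^ 2 ≤ (T + C) ^ 2 * (‖a‖ + d) ^ 2 := by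
        rw [← mul_pow]
        gcongr
        exact hxn m le_rfl
      have h6 : ‖a‖ ^ 2 ≤ (‖a‖ + d) ^ 2 := by gcongr; linarith
      have h7 : ‖a‖ * d ≤ (‖a‖ + d) ^ 2 := by
        nlinarith [mul_nonneg ha0 hd0, sq_nonneg ‖a‖, sq_nonneg d]
      calc _ ≤ (T + C) ^ 2 * (‖a‖ + d) ^ 2 + (C * (‖a‖ + d) ^ 2 + C' * (‖a‖ + d) ^ 2) := by
            rw [mul_left_comm]
            gcongr
        _ = ((T + C) ^ 2 + C + C') * (‖a‖ + d) ^ 2 := by ring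
        _ ≤ _ := mul_le_mul_of_nonneg_right (by linarith) (sq_nonneg _)
  · have hball : ∀ u ∈ Metric.ball (0 : ℂ) R, ‖u‖ ≤ R := fun u hu => by
      simpa using (Metric.mem_ball.1 hu).le
    refine DifferentiableOn.congr ?_ fun u hu => hit u (hball u hu) k hk
    exact differentiableOn_of_isCycleSolution Metric.isOpen_ball
      (fun u hu => hqs u (hball u hu)) (fun u hu => by simp [hq0 u (hball u hu), cycleAnsatz])
      (fun u hu v hv t ht => hslope t _ _ (hq u (hball u hu) t ht).2.2.1
        (hq v (hball v hv) t ht).2.2.1) (hkT k hk)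

/-! ### Isolated zeros and isolated periodic orbits -/

/-- A quantitative form of the open mapping theorem that yields an isolated zero. -/
lemma exists_isolated_zero {f : ℂ → ℂ} {z₀ : ℂ} {s r e : ℝ} (hs : 0 < s) (hsr : s < r)
    (hf : DifferentiableOn ℂ f (Metric.ball z₀ r))
    (hsphere : ∀ z ∈ Metric.sphere z₀ s, e ≤ ‖f z - f z₀‖) (h0 : ‖f z₀‖ < e / 2) :
    ∃ u ∈ Metric.closedBall z₀ s, f u = 0 ∧ ∀ᶠ v in 𝓝[≠] u, f v ≠ 0 := by
  have he : 0 < e := by linarith [norm_nonneg (f z₀)]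
  have han : AnalyticOnNhd ℂ f (Metric.ball z₀ r) := hf.analyticOnNhd Metric.isOpen_ball
  have hpre : IsPreconnected (Metric.ball z₀ r) := (convex_ball z₀ r).isPreconnected
  have hz₀ : z₀ ∈ Metric.ball z₀ r := Metric.mem_ball_self (hs.trans hsr)
  have hsub : Metric.closedBall z₀ s ⊆ Metric.ball z₀ r := Metric.closedBall_subset_ball hsr
  obtain ⟨y, hy⟩ : (Metric.sphere z₀ s).Nonempty := NormedSpace.sphere_nonempty.2 hs.le
  have hyr : y ∈ Metric.ball z₀ r := hsub (Metric.sphere_subset_closedBall hy)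
  -- By the identity theorem, local constancy would contradict the bound on the sphere.
  have hfreq : ∃ᶠ z in 𝓝 z₀, f z ≠ f z₀ := by
    intro h
    have h1 : f =ᶠ[𝓝 z₀] fun _ => f z₀ := h.mono fun z hz => not_not.1 hz
    have h2 := han.eqOn_of_preconnected_of_eventuallyEq analyticOnNhd_const hpre hz₀ h1 hyr
    have h3 := hsphere y hy
    rw [h2, sub_self, norm_zero] at h3
    linarith
  have hcl : DiffContOnCl ℂ f (Metric.ball z₀ s) :=
    (hf.mono (by rw [closure_ball z₀ hs.ne']; exact hsub)).diffContOnCl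
  obtain ⟨u, hu, hfu⟩ := hcl.ball_subset_image_closedBall hs hsphere hfreq
    (show (0 : ℂ) ∈ Metric.ball (f z₀) (e / 2) by simpa using h0)
  refine ⟨u, hu, hfu, ?_⟩
  by_contra hcon
  have h1 : ∃ᶠ v in 𝓝[≠] u, f v = 0 := by
    rw [Filter.not_eventually] at hcon
    exact hcon.mono fun v hv => not_not.1 hv
  have h2 := han.eqOn_zero_of_preconnected_of_frequently_eq_zero hpre (hsub hu) h1
  have h3 := hsphere y hy
  rw [h2 hyr, h2 hz₀] at h3
  simp only [Pi.zero_apply, sub_zero, norm_zero] at h3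
  linarith

/-- An isolated fixed point of the `m`-th iterate lies on an isolated periodic orbit. -/
lemma isIsolatedPeriodicOrbit_of_isolated {P : ℂ → ℂ} {D : Set ℂ} {m : ℕ} {u : ℂ} (hm : 0 < m)
    (hD : IsOpen D) (hP : ∀ k ≤ m, ContinuousOn P^[k] D) (horb : ∀ k < m, P^[k] u ∈ D)
    (hper : P^[m] u = u) (hmin : ∀ k, 0 < k → k < m → P^[k] u ≠ u)
    (hiso : ∀ᶠ v in 𝓝[≠] u, P^[m] v ≠ v) : IsIsolatedPeriodicOrbit P D m u := by
  have hper' : Function.IsPeriodicPt P m u := hper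
  refine ⟨?_, fun j hj => ⟨horb j hj, ?_⟩⟩
  · have h1 := hper'.minimalPeriod_pos hm
    have h2 := hper'.minimalPeriod_le hm
    by_contra hne
    exact hmin _ h1 (lt_of_le_of_ne h2 hne) (Function.iterate_minimalPeriod (f := P) (x := u))
  · have horb' : ∀ k, P^[k] u ∈ D := fun k => by
      rw [← hper'.iterate_mod_apply k]
      exact horb _ (Nat.mod_lt _ hm)
    have hcont : ∀ k ≤ m, ContinuousAt P^[k] (P^[j] u) := fun k hk =>
      (hP k hk).continuousAt (hD.mem_nhds (horb' j))
    have h1 : ∀ᶠ v in 𝓝 (P^[j] u), ∀ k ∈ Set.Iio m, P^[k] v ∈ D := by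
      refine (Filter.eventually_all_finite (Set.finite_Iio m)).2 fun k hk => ?_
      refine (hcont k (le_of_lt hk)).eventually_mem (hD.mem_nhds ?_)
      rw [← Function.iterate_add_apply]
      exact horb' _
    -- `P^[m - j]` carries this orbit point back to `u`, so isolation at `u` pulls back by
    -- continuity; applying `P^[j]` afterwards recovers a fixed `v`.
    have h2 : ∀ᶠ v in 𝓝 (P^[j] u), P^[m] (P^[m - j] v) = P^[m - j] v → P^[m - j] v = u := by
      have h3 : P^[m - j] (P^[j] u) = u := by
        rw [← Function.iterate_add_apply, Nat.sub_add_cancel hj.le, hper]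
      have h4 := (hcont (m - j) (Nat.sub_le _ _)).tendsto
      rw [h3] at h4
      have h5 : ∀ᶠ v in 𝓝 u, P^[m] v = v → v = u :=
        (eventually_nhdsWithin_iff.1 hiso).mono fun v hv hfix => by
          by_contra hne
          exact hv hne hfix
      exact h4.eventually h5
    refine ⟨_, h1.and h2, fun v hv => ⟨hv.1, fun hfix => ?_⟩⟩
    have h5 : P^[m - j] v = u := hv.2 (by
      rw [← Function.iterate_add_apply, Nat.add_comm, Function.iterate_add_apply, hfix])
    rw [← h5, ← Function.iterate_add_apply, Nat.add_sub_cancel' hj.le, hfix]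

/-! ### Choice of parameters and conclusion -/

lemma eventually_mul_lt {K b : ℝ} (hb : 0 < b) : ∀ᶠ x in 𝓝[>] (0 : ℝ), K * x < b := by
  have h : Filter.Tendsto (fun x : ℝ => K * x) (𝓝 0) (𝓝 (K * 0)) :=
    (continuous_const.mul continuous_id).tendsto 0
  rw [mul_zero] at h
  exact nhdsWithin_le_nhds (h.eventually (gt_mem_nhds hb))

/-- The base is a primitive `m`-th root of unity and only finitely many powers occur. The gap `γ`
excludes periods smaller than `m`. -/
lemma exists_le_norm_exp_sub_one {m : ℕ} (hm : 0 < m) : ∃ γ : ℝ, 0 < γ ∧ ∀ k : ℕ, 0 < k → k < m →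
    γ ≤ ‖Complex.exp (2 * Real.pi * k * (Complex.I / m)) - 1‖ := by
  have hne : ∀ k ∈ Finset.Ioo 0 m,
      0 < ‖Complex.exp (2 * Real.pi * k * (Complex.I / m)) - 1‖ := by
    intro k hk
    obtain ⟨h0, h1⟩ := Finset.mem_Ioo.1 hk
    rw [norm_pos_iff, sub_ne_zero]
    have h2 := (Complex.isPrimitiveRoot_exp m hm.ne').pow_ne_one_of_pos_of_lt h0.ne' h1
    rw [← Complex.exp_nat_mul] at h2
    have h3 : 2 * Real.pi * k * (Complex.I / m) = k * (2 * Real.pi * Complex.I / m) := by ring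
    rwa [h3]
  rcases (Finset.Ioo 0 m).eq_empty_or_nonempty with he | he
  · refine ⟨1, one_pos, fun k h0 h1 => ?_⟩
    have := Finset.mem_Ioo.2 ⟨h0, h1⟩
    simp [he] at this
  · obtain ⟨k, hk, hmin⟩ := Finset.exists_min_image _
      (fun k : ℕ => ‖Complex.exp (2 * Real.pi * k * (Complex.I / m)) - 1‖) he
    exact ⟨_, hne k hk, fun j h0 h1 => hmin j (Finset.mem_Ioo.2 ⟨h0, h1⟩)⟩

/-- The derivative `m u₀^(m-1)` is nonzero, so `u₀` is an isolated root of `u^m - u₀^m`; compactness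
of a small sphere gives the bound. -/
lemma exists_sphere_pow_sub_pow {m : ℕ} (hm : 0 < m) {u₀ : ℂ} (hu₀ : u₀ ≠ 0) {b : ℝ} (hb : 0 < b) :
    ∃ s μ : ℝ, 0 < s ∧ s < b ∧ 0 < μ ∧ ∀ u ∈ Metric.sphere u₀ s, μ ≤ ‖u ^ m - u₀ ^ m‖ := by
  have hd : (m : ℂ) * u₀ ^ (m - 1) ≠ 0 :=
    mul_ne_zero (by exact_mod_cast hm.ne') (pow_ne_zero _ hu₀)
  have h1 := (hasDerivAt_pow m u₀).eventually_ne (c := u₀ ^ m) hd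
  obtain ⟨δ, hδ, hball⟩ := Metric.eventually_nhds_iff.1 (eventually_nhdsWithin_iff.1 h1)
  have hmin : 0 < min δ b := lt_min hδ hb
  have hs : 0 < min δ b / 2 := half_pos hmin
  have hslt : min δ b / 2 < min δ b := half_lt_self hmin
  obtain ⟨y, hy, hymin⟩ := (isCompact_sphere u₀ (min δ b / 2)).exists_isMinOn
    (NormedSpace.sphere_nonempty.2 hs.le)
    (f := fun u => ‖u ^ m - u₀ ^ m‖) (by fun_prop)
  have hyd : dist y u₀ = min δ b / 2 := hy
  refine ⟨min δ b / 2, ‖y ^ m - u₀ ^ m‖, hs, hslt.trans_le (min_le_right _ _), ?_, fun u hu =>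
    hymin hu⟩
  rw [norm_pos_iff, sub_ne_zero]
  refine hball (by rw [hyd]; exact hslt.trans_le (min_le_left _ _)) fun h => ?_
  rw [Set.mem_singleton_iff.1 h, dist_self] at hyd
  linarith

/-- During one turn `u exp(εt)` grows at most by `exp(2π r₃)`. Starting below half the inverse of
this factor keeps it in the disc of radius `1/2`, where solutions exist for small `a`. -/
theorem exists_cyclePoincareWellDefined {r₃ : ℝ} (hr₃ : 0 < r₃) :
    ∃ r₁ r₂ : ℝ, 0 < r₁ ∧ r₁ < 1 ∧ 0 < r₂ ∧ CyclePoincareWellDefined r₁ r₂ r₃ := by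
  have h2 : (0 : ℝ) ≤ 1 / 2 := by norm_num
  obtain ⟨C, a₀, -, ha₀, hsol⟩ := exists_cycleSolution h2 (by norm_num : (1 / 2 : ℝ) < 1) hr₃.le
    Real.two_pi_pos.le
  have hexp : 0 < Real.exp (-(r₃ * (2 * Real.pi))) := Real.exp_pos _
  have hexp1 : Real.exp (-(r₃ * (2 * Real.pi))) ≤ 1 :=
    Real.exp_le_one_iff.2 (neg_nonpos.2 (by positivity))
  refine ⟨Real.exp (-(r₃ * (2 * Real.pi))) / 2, a₀, by positivity, by linarith, ha₀,
    fun a ha ε hε u hu => ?_⟩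
  rw [mem_ball_zero_iff] at ha hε hu
  obtain ⟨q, hq0, hq, -⟩ := (hsol a ε ha.le hε.le).2 u fun t ht => by
    have h3 : ‖Complex.exp (ε * t)‖ ≤ Real.exp (r₃ * (2 * Real.pi)) := by
      rw [Complex.norm_exp]
      refine Real.exp_le_exp.2 ((Complex.re_le_norm _).trans ?_)
      rw [norm_mul, Complex.norm_real, Real.norm_of_nonneg ht.1]
      exact mul_le_mul hε.le ht.2 ht.1 hr₃.le
    rw [norm_mul]
    calc _ ≤ Real.exp (-(r₃ * (2 * Real.pi))) / 2 * Real.exp (r₃ * (2 * Real.pi)) := by gcongr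
      _ = 1 / 2 := by
        rw [div_mul_eq_mul_div, ← Real.exp_add, neg_add_cancel, Real.exp_zero]
  have hret : IsCycleReturn a ε u (cycleAnsatz ε u (2 * Real.pi) (q (2 * Real.pi))) :=
    ⟨_, isCycleLift_iff.2 hq, by simp [hq0, cycleAnsatz], rfl⟩
  exact ⟨_, hret, fun v hv => hv.unique hret⟩

/-- Isolated periodic orbits of exact period `m` for parameters close to `i / m`. -/
theorem exists_isIsolatedPeriodicOrbit {r₁ r₂ r₃ : ℝ} (hr₁ : 0 < r₁) (hr₁1 : r₁ < 1)
    (hr₂ : 0 < r₂) {m : ℕ} (hm : 0 < m)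
    (hmem : Complex.I / (m : ℂ) ∈ Metric.ball (0 : ℂ) r₃) {δ : ℝ} (hδ : 0 < δ) :
    ∃ εm ∈ Metric.ball (Complex.I / (m : ℂ)) δ,
      ∃ am ∈ Metric.ball (0 : ℂ) r₂, ∃ ρ : ℝ, 0 < ρ ∧
        Metric.ball εm ρ ⊆ Metric.ball (0 : ℂ) r₃ ∧
        ∀ ε ∈ Metric.ball εm ρ, ∃ u : ℂ, u ≠ 0 ∧
          IsIsolatedPeriodicOrbit (cyclePoincare am ε) (Metric.ball (0 : ℂ) r₁) m u := by
  obtain ⟨C, a₀, hC, ha₀, hexpand⟩ := exists_iterate_cyclePoincare hm hr₁.le hr₁1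
  obtain ⟨γ, hγ, hγk⟩ := exists_le_norm_exp_sub_one hm
  have hu₀ : ((r₁ / 2 : ℝ) : ℂ) ≠ 0 := by exact_mod_cast (half_pos hr₁).ne'
  obtain ⟨s, μ, hs, hsr, hμ, hsphere⟩ :=
    exists_sphere_pow_sub_pow hm hu₀ (by linarith : 0 < r₁ / 4)
  set u₀ : ℂ := ((r₁ / 2 : ℝ) : ℂ) with hu₀_def
  have hu₀n : ‖u₀‖ = r₁ / 2 := by
    rw [hu₀_def, Complex.norm_real, Real.norm_of_nonneg (half_pos hr₁).le]
  set κ := Complex.I / (m : ℂ)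
  have hκ3 : ‖κ‖ < r₃ := by simpa using hmem
  have hmR : (0 : ℝ) < 2 * Real.pi * m := by positivity
  have hmC : (2 * Real.pi * m : ℂ) ≠ 0 := by exact_mod_cast hmR.ne'
  set N := ‖cycleC m‖ with hN
  have hN0 : 0 < N := norm_pos_iff.2 (cycleC_ne_zero hm)
  set L := N / (2 * Real.pi * m) with hL
  have hL0 : 0 < L := by positivity
  set B := C * (L + 2) ^ 2 + 2 * Real.pi * m with hB
  have hB0 : 0 < B := by positivity
  -- `x > 0` will be the value of `a`; the conditions are exactly the finitely many smallness
  -- requirements used below.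
  obtain ⟨x, hx, hx0⟩ := ((((((((eventually_mul_lt (K := 1) hr₂).and
    (eventually_mul_lt (K := 1) one_pos)).and (eventually_mul_lt (K := 1) ha₀)).and
    (eventually_mul_lt (K := L + 1) ha₀)).and (eventually_mul_lt (K := L) hδ)).and
    (eventually_mul_lt (K := L + 1) (sub_pos.2 hκ3))).and
    (eventually_mul_lt (K := 4 * B) (by positivity : 0 < r₁ / 4 * N * μ))).and
    (eventually_mul_lt (K := C * (L + 2)) (lt_min (by norm_num : (0 : ℝ) < 1 / 4) hγ))).and
    self_mem_nhdsWithin |>.exists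
  obtain ⟨⟨⟨⟨⟨⟨⟨h₂, h₁⟩, hxa⟩, hLa⟩, hLδ⟩, hL3⟩, hBx⟩, hCx⟩ := hx
  replace hx0 : 0 < x := hx0
  rw [one_mul] at h₂ h₁ hxa
  have hxn : ‖(x : ℂ)‖ = x := by rw [Complex.norm_real, Real.norm_of_nonneg hx0.le]
  -- The solution of `2πm (ε - i/m) + x c_m u₀^m = 0`.
  set εm := κ - x * cycleC m * u₀ ^ m / (2 * Real.pi * m) with hεm
  have hεmκ : ‖εm - κ‖ ≤ L * x := by
    have h3 : εm - κ = -(x * cycleC m * u₀ ^ m / (2 * Real.pi * m)) := by rw [hεm]; ring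
    have h4 : ‖(2 * Real.pi * m : ℂ)‖ = 2 * Real.pi * m := by
      have : (2 * Real.pi * m : ℂ) = ((2 * Real.pi * m : ℝ) : ℂ) := by push_cast; rfl
      rw [this, Complex.norm_real, Real.norm_of_nonneg hmR.le]
    rw [h3, norm_neg, norm_div, norm_mul, norm_mul, h4, norm_pow, hxn, hu₀n, hL]
    have h5 : (r₁ / 2) ^ m ≤ 1 := pow_le_one₀ (by positivity) (by linarith)
    calc x * N * (r₁ / 2) ^ m / (2 * Real.pi * m) ≤ x * N * 1 / (2 * Real.pi * m) := by gcongr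
      _ = _ := by ring
  have hx2 : x ^ 2 ≤ x := by nlinarith
  have hdist : ∀ ε ∈ Metric.ball εm (x ^ 2), ‖ε - κ‖ ≤ (L + 1) * x := by
    intro ε hε
    rw [mem_ball_iff_norm] at hε
    have h3 := norm_add_le (ε - εm) (εm - κ)
    rw [sub_add_sub_cancel] at h3
    linarith
  -- Radius `x²` for `ε`: such a shift costs `2πm x²`, the order of the remainder already present.
  refine ⟨εm, mem_ball_iff_norm.2 (hεmκ.trans_lt hLδ), x, by simpa [abs_of_pos hx0] using h₂, x ^ 2,
    by positivity, fun ε hε => ?_, fun ε hε => ?_⟩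
  · have h3 := norm_sub_norm_le ε κ
    rw [mem_ball_zero_iff]
    linarith [hdist ε hε]
  have hεκ := hdist ε hε
  obtain ⟨hP, hdiff⟩ := hexpand x ε (hxn.trans_le hxa.le) (hεκ.trans hLa.le)
  rw [hxn] at hP
  set P := cyclePoincare x ε
  have hsum : x + ‖ε - κ‖ ≤ (L + 2) * x := by linarith
  have hsum0 : 0 ≤ x + ‖ε - κ‖ := by positivity
  have hf : ∀ u : ℂ, ‖u‖ ≤ r₁ →
      ‖P^[m] u - u - u * (x * cycleC m * (u ^ m - u₀ ^ m))‖ ≤ B * x ^ 2 := by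
    intro u hu
    have h3 := (hP u hu).2.2
    have h4 : P^[m] u - u - u * (x * cycleC m * (u ^ m - u₀ ^ m)) =
        (P^[m] u - u * (1 + 2 * Real.pi * m * (ε - κ) + x * cycleC m * u ^ m)) +
        u * (2 * Real.pi * m * (ε - εm)) := by
      have h5 : 2 * Real.pi * m * (ε - εm) = 2 * Real.pi * m * (ε - κ) +
          x * cycleC m * u₀ ^ m := by
        rw [hεm]
        linear_combination div_mul_cancel₀ (x * cycleC m * u₀ ^ m) hmC
      rw [h5]
      ring
    have h6 : ‖u * (2 * Real.pi * m * (ε - εm))‖ ≤ 2 * Real.pi * m * x ^ 2 := by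
      have h7 : (2 * Real.pi * m : ℂ) = ((2 * Real.pi * m : ℝ) : ℂ) := by push_cast; rfl
      rw [mem_ball_iff_norm] at hε
      rw [h7, norm_mul, norm_mul, Complex.norm_real, Real.norm_of_nonneg hmR.le]
      calc _ ≤ 1 * (2 * Real.pi * m * x ^ 2) := by
            gcongr
            linarith
        _ = _ := one_mul _
    rw [h4]
    refine (norm_add_le _ _).trans ((add_le_add (h3.trans ?_) h6).trans_eq
      (b := C * (L + 2) ^ 2 * x ^ 2 + 2 * Real.pi * m * x ^ 2) ?_)
    · calc _ ≤ C * ((L + 2) * x) ^ 2 * 1 := by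
            gcongr
            linarith
        _ = _ := by ring
    · rw [hB]
      ring
  have hin : ∀ u ∈ Metric.closedBall u₀ (r₁ / 4), r₁ / 4 ≤ ‖u‖ ∧ ‖u‖ ≤ 3 / 4 * r₁ := by
    intro u hu
    rw [mem_closedBall_iff_norm] at hu
    have h3 := norm_sub_norm_le u u₀
    have h4 := norm_sub_norm_le u₀ u
    rw [norm_sub_rev u₀ u] at h4
    constructor <;> linarith
  have hball : Metric.ball u₀ (r₁ / 4) ⊆ Metric.ball 0 r₁ := fun u hu => by
    rw [mem_ball_zero_iff]
    linarith [(hin u (Metric.ball_subset_closedBall hu)).2]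
  have hf₀ : ‖P^[m] u₀ - u₀‖ ≤ B * x ^ 2 := by
    have := hf u₀ (by linarith)
    simpa using this
  have hBx' : 4 * B * x ^ 2 < r₁ / 4 * N * μ * x := by nlinarith
  -- On the sphere the main term is of order `x`, and the errors at `z` and at `u₀` cost `B x²`
  -- each. The condition `‖f u₀‖ < e/2` is then what the factor 4 in `hBx'` provides.
  obtain ⟨u, hu, hfu, hiso⟩ := exists_isolated_zero (f := fun u => P^[m] u - u) (z₀ := u₀)
    (e := r₁ / 4 * N * μ * x - 2 * (B * x ^ 2)) hs hsr
    (((hdiff m le_rfl).sub differentiableOn_id).mono hball) (fun z hz => by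
      have hz' := hin z (Metric.closedBall_subset_closedBall hsr.le
        (Metric.sphere_subset_closedBall hz))
      have h3 := hf z (by linarith)
      have h4 : r₁ / 4 * N * μ * x ≤ ‖z * (x * cycleC m * (z ^ m - u₀ ^ m))‖ := by
        rw [norm_mul, norm_mul, norm_mul, hxn]
        calc r₁ / 4 * N * μ * x = r₁ / 4 * (x * N * μ) := by ring
          _ ≤ _ := by
            gcongr
            · exact hz'.1
            · exact hsphere z hz
      have h5 := norm_sub_norm_le (z * (x * cycleC m * (z ^ m - u₀ ^ m))) (P^[m] z - z)
      rw [norm_sub_rev _ (P^[m] z - z)] at h5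
      have h6 := norm_sub_norm_le (P^[m] z - z) (P^[m] u₀ - u₀)
      linarith) (by linarith)
  have huin := hin u (Metric.closedBall_subset_closedBall hsr.le hu)
  have hu1 : ‖u‖ ≤ r₁ := by linarith
  have hu0 : 0 < ‖u‖ := by linarith
  have hCx' : C * (x + ‖ε - κ‖) < min (1 / 4) γ := by
    refine lt_of_le_of_lt ?_ hCx
    rw [mul_assoc]
    gcongr
  have hek : ∀ k : ℕ, ‖u * Complex.exp (2 * Real.pi * k * κ)‖ = ‖u‖ := by
    intro k
    have h1 : 2 * Real.pi * k * κ = κ * ((2 * Real.pi * k : ℝ) : ℂ) := by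
      push_cast
      ring
    rw [norm_mul, h1, norm_exp_I_div, mul_one]
  refine ⟨u, norm_pos_iff.1 hu0, isIsolatedPeriodicOrbit_of_isolated hm Metric.isOpen_ball
    (fun k hk => (hdiff k hk).continuousOn) (fun k hk => ?_) (sub_eq_zero.1 hfu)
    (fun k hk0 hk heq => ?_) (hiso.mono fun v hv => sub_ne_zero.1 hv)⟩
  -- The orbit stays in the disc because `(1 + 1/4) · (3/4) r₁ < r₁`.
  · have h3 := (hP u hu1).2.1 k hk.le
    have h4 := norm_sub_norm_le (P^[k] u) (u * Complex.exp (2 * Real.pi * k * κ))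
    have h5 := mul_le_mul_of_nonneg_right (hCx'.le.trans (min_le_left _ _)) hu0.le
    rw [hek] at h4
    rw [mem_ball_zero_iff]
    linarith
  -- An earlier return would put the rotation by `k/m` of a turn within less than `γ ‖u‖` of the
  -- identity at `u`.
  · have h3 := (hP u hu1).2.1 k hk.le
    have h4 := hγk k hk0 hk
    have h5 : P^[k] u - u * Complex.exp (2 * Real.pi * k * κ) =
        -(u * (Complex.exp (2 * Real.pi * k * κ) - 1)) := by
      rw [heq]
      ring
    rw [h5, norm_neg, norm_mul] at h3
    have h6 := mul_lt_mul_of_pos_right (hCx'.trans_le (min_le_right _ _)) hu0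
    have h7 := mul_le_mul_of_nonneg_left h4 hu0.le
    linarith

theorem mainTheorem2 :
    -- for every `r₃` there are radii for which the Poincaré map is well defined
    (∀ r₃ : ℝ, 0 < r₃ → ∃ r₁ r₂ : ℝ, 0 < r₁ ∧ r₁ < 1 ∧ 0 < r₂ ∧
      CyclePoincareWellDefined r₁ r₂ r₃) ∧
    ∀ r₁ r₂ r₃ : ℝ, 0 < r₁ → r₁ < 1 → 0 < r₂ → 0 < r₃ → CyclePoincareWellDefined r₁ r₂ r₃ →
      ∀ m : ℕ, 0 < m → Complex.I / (m : ℂ) ∈ Metric.ball (0 : ℂ) r₃ →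
        -- isolated periodic orbits of exact period `m`
        (∀ δ : ℝ, 0 < δ → ∃ εm ∈ Metric.ball (Complex.I / (m : ℂ)) δ,
          ∃ am ∈ Metric.ball (0 : ℂ) r₂, ∃ ρ : ℝ, 0 < ρ ∧
            Metric.ball εm ρ ⊆ Metric.ball (0 : ℂ) r₃ ∧
            ∀ ε ∈ Metric.ball εm ρ, ∃ u : ℂ, u ≠ 0 ∧
              IsIsolatedPeriodicOrbit (cyclePoincare am ε) (Metric.ball (0 : ℂ) r₁) m u) ∧
        -- the first order term of `P^m` at `ε = i / m`
        cycleC m ≠ 0 ∧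
        ∃ C ρ : ℝ, 0 < ρ ∧ ∀ a ∈ Metric.ball (0 : ℂ) ρ, ∀ u ∈ Metric.ball (0 : ℂ) r₁,
          (∀ k < m, ∃! v, IsCycleReturn a (Complex.I / (m : ℂ))
            ((cyclePoincare a (Complex.I / (m : ℂ)))^[k] u) v) ∧
          ‖(cyclePoincare a (Complex.I / (m : ℂ)))^[m] u - (u + a * cycleC m * u ^ (m + 1))‖
            ≤ C * ‖a‖ ^ 2 * ‖u‖ := by
  refine ⟨fun r₃ hr₃ => exists_cyclePoincareWellDefined hr₃,
    fun r₁ r₂ r₃ hr₁ hr₁1 hr₂ _ _ m hm hmem => ⟨fun δ hδ =>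
      exists_isIsolatedPeriodicOrbit hr₁ hr₁1 hr₂ hm hmem hδ, cycleC_ne_zero hm, ?_⟩⟩
  obtain ⟨C, a₀, -, ha₀, hexpand⟩ := exists_iterate_cyclePoincare hm hr₁.le hr₁1
  refine ⟨C, a₀, ha₀, fun a ha u hu => ?_⟩
  rw [mem_ball_zero_iff] at ha hu
  obtain ⟨hret, -, hfirst⟩ := (hexpand a (Complex.I / m) ha.le (by simpa using ha₀.le)).1 u hu.le
  refine ⟨fun k hk => ⟨_, hret k hk, fun v hv => hv.unique (hret k hk)⟩, ?_⟩
  have h : u + a * cycleC m * u ^ (m + 1) = u * (1 + 2 * Real.pi * m *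
      (Complex.I / m - Complex.I / m) + a * cycleC m * u ^ m) := by ring
  rw [h]
  simpa using hfirst
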